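/- **Setting.** Let $\langle\!\langle\cdot,\cdot\rangle\!\rangle$ be the Minkowski inner product on $\mathbb R^{n+2}_1$, let $\mathcal L^{n+1}$ be the light cone (nonzero null vectors), and identify the conformal sphere $S^n$ with the set $\mathbb P(\mathcal L^{n+1})$ of null lines $\langle v\rangle$, with its quotient topology; the Lorentz group $O(\mathbb R^{n+2}_1)$ acts by $A\langle v\rangle=\langle Av\rangle$. Write $w^*(x)=\langle\!\langle w,x\rangle\!\rangle$ and $(v\wedge w)(x)=\langle\!\langle v,x\rangle\!\rangle w-\langle\!\langle w,x\rangle\!\rangle v$. For a Lie algebra valued $1$-form $\psi$ on $(0,b)$ and $p\in(0,b)$, let $t\mapsto\Gamma_p^{\,t}(\psi)$ be the solution with values in the Lorentz group of $d\Gamma_p(\psi)=\Gamma_p(\psi)\psi$, $\Gamma_p^{\,p}(\psi)=\mathrm{id}$. Let $\varepsilon,b>0$ and let $\langle c\rangle:(-\varepsilon,b)\to S^n$ be a smooth immersion with smooth light cone lift $c$. Let $Q=Q(t)\,dt^2$ be a nowhere zero quadratic differential on $(0,b)$ with a pole of second order at $0$: $t^2Q(t)$ extends smoothly to $(-\varepsilon',b)$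 for some $\varepsilon'>0$, with value $q\neq0$ at $0$. Let $\omega=\frac{Q(t)}{\|c'(t)\|^2}\,c(t)\wedge c'(t)\,dt$, which does not depend on the lift. For $\lambda\in\mathbb R$ and $p\in(0,b)$, the $\lambda$-Calapso transform normalized at $p$ is $\langle c_{\lambda,p}(t)\rangle=\Gamma_p^{\,t}(\lambda\omega)\langle c(t)\rangle$. **Theorem.** Let $\lambda\in\mathbb R$, put $\mu=\lambda q$ and assume $1-2\mu\ge0$. (1) For every $p\in(0,b)$, the Calapso transform $\langle c_{\lambda,p}(t)\rangle$ converges in $S^n$ as $t\to0^+$. (2) The limit is as follows. Let $0<\delta\le\varepsilon$ and let $s:(-\delta,b)\to\mathbb R$ be smooth with $s(0)=0$, $s'>0$ and $Q=q\,ds^2/s^2$ on $(0,b)$. Let $o,\iota$ be null vectors and $\mathfrak t$ a unit vector with $\langle\!\langle o,\iota\rangle\!\rangle=-1$ and $\mathfrak t\perp o,\iota$. Let $F:(-\delta,b)\to O(\mathbb R^{n+2}_1)$ be a smooth frame such that $f=Fo$ is a lift of $\langle c\rangle$ with $f'=s'F\mathfrak t$ and such that, for all constant $x,y\perp o,\iota,\mathfrak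 t$, the normal fields $Fx,Fy$ satisfy $\langle\!\langle (Fx)',F\mathfrak t\rangle\!\rangle=0$ and $\langle\!\langle (Fx)',Fy\rangle\!\rangle=0$. Let $g=FR$ on $(0,b)$, where $R(t)o=s(t)^{-1}o$, $R(t)\iota=s(t)\iota$ and $R(t)=\mathrm{id}$ on $\{o,\iota\}^\perp$, and let $\psi=g^{-1}(\lambda\omega)g+g^{-1}dg$. Put $$v_\pm=\tfrac12\bigl(1\pm\sqrt{1-2\mu}\bigr)^2o+\iota-\bigl(1\pm\sqrt{1-2\mu}\bigr)\mathfrak t ,$$ which are null eigenvectors of $(o-\mathfrak t)\wedge(\iota-\mu\mathfrak t)$ with eigenvalues $\pm\sqrt{1-2\mu}$. Then there is a continuous map $k_\lambda:[0,b)\to\mathcal L^{n+1}$ with $\langle k_\lambda(0)\rangle=\langle v_+\rangle$ such that, for all $p,t\in(0,b)$, $\langle k_\lambda(t)\rangle=\Gamma_t^{\,p}(\psi)\langle k_\lambda(p)\rangle$, and for all $p\in(0,b)$ $$\lim_{t\to0^+}\langle\Gamma_p^{\,t}(\psi)\rangle=\langle k_\lambda(p)v_-^*\rangle\ \text{ in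 }\ \mathbb P\,\mathrm{End}(\mathbb R^{n+2}_1),\qquad \lim_{t\to0^+}\langle c_{\lambda,p}(t)\rangle=g(p)\langle k_\lambda(p)\rangle .$$ For $Q=dt^2/t^2$ one has $q=1$, may take $s(t)=t$, and the condition is $1-2\lambda\ge0$. -/

import Mathlib

open Set Filter Topology
open scoped ContDiff LinearAlgebra.Projectivization

noncomputable section

/-- The quotient topology on a projective space. -/
instance projectivizationTopology (V : Type*) [AddCommGroup V] [Module ℝ V] [TopologicalSpace V] :
    TopologicalSpace (ℙ ℝ V) :=
  TopologicalSpace.coinduced (Projectivization.mk' ℝ) inferInstance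

namespace Moebius

/-! ### Minkowski space, light cone, conformal sphere, Lorentz group -/

/-- The vector space underlying `(n + 2)`-dimensional Minkowski space. -/
abbrev Mink (n : ℕ) : Type := Fin (n + 2) → ℝ

/-- Endomorphisms of Minkowski space (with the operator norm topology). -/
abbrev End (n : ℕ) : Type := Mink n →L[ℝ] Mink n

/-- The Minkowski inner product `- x₀ y₀ + x₁ y₁ + ⋯ + xₙ₊₁ yₙ₊₁`. -/
def mink (n : ℕ) : LinearMap.BilinForm ℝ (Mink n) :=
  LinearMap.mk₂ ℝ (fun x y => -(x 0 * y 0) + ∑ i : Fin (n + 1), x i.succ * y i.succ)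
    (by
      intro x y z
      simp only [Pi.add_apply, add_mul, Finset.sum_add_distrib]
      ring)
    (by
      intro a x y
      simp only [Pi.smul_apply, smul_eq_mul, mul_assoc, ← Finset.mul_sum]
      ring)
    (by
      intro x y z
      simp only [Pi.add_apply, mul_add, Finset.sum_add_distrib]
      ring)
    (by
      intro a x y
      simp only [Pi.smul_apply, smul_eq_mul, mul_left_comm _ a, ← Finset.mul_sum]
      ring)

theorem mink_apply {n : ℕ} (x y : Mink n) :
    mink n x y = -(x 0 * y 0) + ∑ i : Fin (n + 1), x i.succ * y i.succ := rfl

theorem mink_comm {n : ℕ} (x y : Mink n) : mink n x y = mink n y x := by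
  simp only [mink_apply, mul_comm]

theorem mink_nondegenerate {n : ℕ} {w : Mink n} (hw : w ≠ 0) : ∃ x, mink n w x ≠ 0 := by
  by_contra! h
  apply hw
  funext j
  have hj := h (Pi.single j 1)
  rw [mink_apply] at hj
  refine Fin.cases (fun hj => ?_) (fun i hj => ?_) j hj
  · simpa [Pi.single_apply, Fin.succ_ne_zero] using hj
  · simpa [Pi.single_apply, (Fin.succ_ne_zero i).symm] using hj

/-- The light cone: the nonzero null vectors. -/
abbrev LightCone (n : ℕ) : Type := {v : Mink n // v ≠ 0 ∧ mink n v v = 0}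

/-- The conformal `n`-sphere: the projectivization of the light cone, i.e. the set of null lines,
topologized as a subspace of the projective space of Minkowski space. -/
abbrev Sphere (n : ℕ) : Type := {P : ℙ ℝ (Mink n) // ∀ v ∈ P.submodule, mink n v v = 0}

/-- The point `⟨v⟩` of the sphere spanned by a light cone vector `v`. -/
def LightCone.span {n : ℕ} (v : LightCone n) : Sphere n :=
  ⟨Projectivization.mk ℝ (v : Mink n) v.2.1, by
    intro w hw
    rw [Projectivization.submodule_mk, Submodule.mem_span_singleton] at hw
    obtain ⟨a, rfl⟩ := hw
    simp [v.2.2]⟩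

/-- The Lorentz group `O(n + 1, 1)`, as a subgroup of the linear automorphisms. -/
def lorentzGroup (n : ℕ) : Subgroup (Mink n ≃L[ℝ] Mink n) where
  carrier := {A | ∀ x y, mink n (A x) (A y) = mink n x y}
  one_mem' := fun _ _ => rfl
  mul_mem' := by
    intro A B hA hB x y
    exact (hA (B x) (B y)).trans (hB x y)
  inv_mem' := by
    intro A hA x y
    have h := hA (A.symm x) (A.symm y)
    rw [A.apply_symm_apply, A.apply_symm_apply] at h
    exact h.symm

/-- The type of Lorentz transformations. -/
abbrev Lorentz (n : ℕ) : Type := lorentzGroup n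

theorem mem_lorentzGroup {n : ℕ} {A : Mink n ≃L[ℝ] Mink n} :
    A ∈ lorentzGroup n ↔ ∀ x y, mink n (A x) (A y) = mink n x y := Iff.rfl

/-- The linear automorphism underlying a Lorentz transformation. -/
def Lorentz.toEquiv {n : ℕ} (A : Lorentz n) : Mink n ≃L[ℝ] Mink n := A.1

/-- The endomorphism underlying a Lorentz transformation. -/
def Lorentz.toEnd {n : ℕ} (A : Lorentz n) : End n := A.toEquiv

/-- The Möbius transformation of the sphere induced by a Lorentz transformation `A`, that is,
the action of `⟨A⟩ ∈ P O(n + 1, 1)`: `⟨v⟩ ↦ ⟨A v⟩`. -/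
def Lorentz.act {n : ℕ} (A : Lorentz n) (P : Sphere n) : Sphere n :=
  ⟨Projectivization.map A.toEquiv.toLinearEquiv.toLinearMap
      A.toEquiv.injective P.1, by
    obtain ⟨P, hP⟩ := P
    induction P with
    | h v hv =>
      intro w hw
      simp only [Projectivization.map_mk, Projectivization.submodule_mk,
        Submodule.mem_span_singleton] at hw
      obtain ⟨a, rfl⟩ := hw
      have h1 : mink n v v = 0 := hP v (by
        rw [Projectivization.submodule_mk]; exact Submodule.mem_span_singleton_self v)
      have h2 : mink n (A.toEquiv v) (A.toEquiv v) = 0 :=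
        (A.2 v v).trans h1
      simp only [map_smul, LinearMap.smul_apply, smul_eq_mul]
      have h3 : mink n (A.toEquiv.toLinearEquiv.toLinearMap v)
        (A.toEquiv.toLinearEquiv.toLinearMap v) = 0 := h2
      rw [h3]; simp⟩

/-- The class `⟨A⟩` of a Lorentz transformation in the projective space of `End n`. -/
def Lorentz.projEnd {n : ℕ} (A : Lorentz n) : ℙ ℝ (End n) :=
  Projectivization.mk ℝ A.toEnd (by
    intro h
    have h1 : A.toEquiv (Pi.single 0 1) = 0 :=
      DFunLike.congr_fun h (Pi.single 0 1)
    rw [map_eq_zero_iff _ A.toEquiv.injective] at h1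
    simpa using congrFun h1 0)

/-- The endomorphism `v w^*`, i.e. `x ↦ ⟪w, x⟫ v`. -/
def rankOne {n : ℕ} (v w : Mink n) : End n :=
  LinearMap.toContinuousLinearMap ((mink n w).smulRight v)

/-- The class `⟨v w^*⟩` in the projective space of `End n`, for light cone vectors `v`, `w`. -/
def LightCone.projRankOne {n : ℕ} (v w : LightCone n) : ℙ ℝ (End n) :=
  Projectivization.mk ℝ (rankOne (v : Mink n) (w : Mink n)) (by
    intro h
    obtain ⟨x, hx⟩ := mink_nondegenerate w.2.1
    have h1 : mink n (w : Mink n) x • (v : Mink n) = 0 := DFunLike.congr_fun h x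
    exact (smul_ne_zero hx v.2.1) h1)

/-- The element `v ∧ w` of the Lie algebra `o(n + 1, 1)`: `x ↦ ⟪v, x⟫ w - ⟪w, x⟫ v`. -/
def wedge {n : ℕ} (v w : Mink n) : End n := rankOne w v - rankOne v w

/-! ### Polarized curves, primitives, Calapso transforms -/

/-- `c` is a smooth light cone lift over the open interval `I` of a regular curve `⟨c⟩` in the
sphere. (The differential of `⟨c⟩` at `t` is injective iff `c t` and `c' t` are linearly
independent. Every smooth curve over an interval has a smooth lift.) -/
structure IsRegularLift {n : ℕ} (c : ℝ → LightCone n) (I : Set ℝ) : Prop where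
  smooth : ContDiffOn ℝ ∞ (fun t => (c t : Mink n)) I
  immersion : ∀ t ∈ I, LinearIndependent ℝ ![(c t : Mink n), deriv (fun τ => (c τ : Mink n)) t]

/-- The quadratic differential `Q(t) dt²` on `(a, b)` has a pole of order `k` at `a` with leading
coefficient `q`: the function `Q(t) (a - t)^k` extends smoothly to some `(a - ε, b)` with nonzero
value `q` at `a`. -/
def HasPole (Q : ℝ → ℝ) (a b : ℝ) (k : ℕ) (q : ℝ) : Prop :=
  q ≠ 0 ∧ ∃ ε > 0, ∃ h : ℝ → ℝ, ContDiffOn ℝ ∞ h (Ioo (a - ε) b) ∧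
    (∀ t ∈ Ioo a b, h t = Q t * (a - t) ^ k) ∧ h a = q

/-- (The coefficient of `dt` of the orthogonal lift of) the 1-form associated to the polarized
curve `(⟨c⟩, Q)`: it is `𝔔 c ∧ dc` with `𝔔 ‖dc‖² = Q`. It does not depend on the lift `c`. -/
def assocForm {n : ℕ} (c : ℝ → LightCone n) (Q : ℝ → ℝ) (t : ℝ) : End n :=
  let c' : Mink n := deriv (fun τ => (c τ : Mink n)) t
  (Q t / mink n c' c') • wedge (c t : Mink n) c'

/-- `Γ` is the primitive `Γ_p(ψ)` on the open interval `I` of the 1-form `ψ(t) dt` with values in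
the Lorentz Lie algebra: `dΓ = Γ ψ` and `Γ(p) = id`. (`A ↦ ⟨A⟩` induces an isomorphism of Lie
algebras `o(n + 1, 1) → po(n + 1, 1)`, and `⟨Γ⟩` is the primitive in the projective Lorentz group;
it acts on the sphere by `Lorentz.act`.) -/
structure IsPrimitive {n : ℕ} (ψ : ℝ → End n) (I : Set ℝ) (p : ℝ) (Γ : ℝ → Lorentz n) : Prop where
  init : Γ p = 1
  hasDerivAt : ∀ t ∈ I, HasDerivAt (fun τ => (Γ τ).toEnd) ((Γ t).toEnd ∘L ψ t) t

/-- The gauge transform `g⁻¹ ψ g + g⁻¹ g'` of the 1-form `ψ(t) dt`. -/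
def gauge {n : ℕ} (g : ℝ → Lorentz n) (ψ : ℝ → End n) (t : ℝ) : End n :=
  (g t)⁻¹.toEnd ∘L ψ t ∘L (g t).toEnd + (g t)⁻¹.toEnd ∘L deriv (fun τ => (g τ).toEnd) t

/-- The Calapso transform `t ↦ Γ(t) ⟨c(t)⟩`, where `Γ = Γ_p(λ ω)`. -/
def calapso {n : ℕ} (c : ℝ → LightCone n) (Γ : ℝ → Lorentz n) (t : ℝ) : Sphere n :=
  (Γ t).act (c t).span

/-! ### The singular gauge transformation -/

/-- The first three vectors `o, ι, τ` of a pseudo-orthonormal basis of Minkowski space: `o`, `ι`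
are null with `⟪o, ι⟫ = -1` and `τ` is a unit vector orthogonal to both. -/
structure PseudoTriple (n : ℕ) where
  o : Mink n
  ι : Mink n
  τ : Mink n
  o_o : mink n o o = 0
  ι_ι : mink n ι ι = 0
  o_ι : mink n o ι = -1
  τ_τ : mink n τ τ = 1
  o_τ : mink n o τ = 0
  ι_τ : mink n ι τ = 0

namespace PseudoTriple

variable {n : ℕ} (B : PseudoTriple n)

/-- `x ↦ x - (r⁻¹ - 1) ⟪ι, x⟫ o - (r - 1) ⟪o, x⟫ ι`. -/
def boostFun (r : ℝ) : Mink n →ₗ[ℝ] Mink n :=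
  LinearMap.id - (mink n B.ι).smulRight ((r⁻¹ - 1) • B.o) - (mink n B.o).smulRight ((r - 1) • B.ι)

theorem boostFun_apply (r : ℝ) (x : Mink n) : B.boostFun r x =
    x - mink n B.ι x • (r⁻¹ - 1) • B.o - mink n B.o x • (r - 1) • B.ι := rfl

theorem ι_o : mink n B.ι B.o = -1 := (mink_comm _ _).trans B.o_ι

theorem boostFun_inv (r : ℝ) (hr : r ≠ 0) (x : Mink n) :
    B.boostFun r⁻¹ (B.boostFun r x) = x := by
  simp only [boostFun_apply, map_sub, map_smul, B.o_o, B.ι_ι, B.o_ι, B.ι_o]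
  ext i
  simp only [Pi.sub_apply, Pi.smul_apply, smul_eq_mul]
  field_simp
  ring

/-- The Lorentz transformation `R` with `R o = r⁻¹ o`, `R ι = r ι` which is the identity on the
orthogonal complement of `o` and `ι` (for `r ≠ 0`). -/
def boost (r : ℝ) : Lorentz n :=
  if hr : r ≠ 0 then
    ⟨(LinearEquiv.ofLinearMap (B.boostFun r) (B.boostFun r⁻¹)
        (LinearMap.ext fun x => by
          simpa using B.boostFun_inv r⁻¹ (inv_ne_zero hr) x)
        (LinearMap.ext fun x => B.boostFun_inv r hr x)).toContinuousLinearEquiv, mem_lorentzGroup.2 <| by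
      intro x y
      change mink n (B.boostFun r x) (B.boostFun r y) = mink n x y
      simp only [boostFun_apply, map_sub, map_smul, LinearMap.sub_apply, LinearMap.smul_apply,
        B.o_o, B.ι_ι, B.o_ι, B.ι_o, smul_eq_mul, mink_comm x B.o, mink_comm x B.ι]
      field_simp
      ring⟩
  else 1

theorem boost_apply {r : ℝ} (hr : r ≠ 0) (x : Mink n) : (B.boost r).toEnd x = B.boostFun r x := by
  rw [boost, dif_pos hr]
  rfl

theorem boost_o {r : ℝ} (hr : r ≠ 0) : (B.boost r).toEnd B.o = r⁻¹ • B.o := by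
  rw [B.boost_apply hr, boostFun_apply, B.ι_o, B.o_o]
  ext i
  simp
  ring

theorem boost_ι {r : ℝ} (hr : r ≠ 0) : (B.boost r).toEnd B.ι = r • B.ι := by
  rw [B.boost_apply hr, boostFun_apply, B.ι_ι, B.o_ι]
  ext i
  simp
  ring

theorem boost_perp {r : ℝ} (hr : r ≠ 0) {x : Mink n} (h1 : mink n B.o x = 0)
    (h2 : mink n B.ι x = 0) : (B.boost r).toEnd x = x := by
  rw [B.boost_apply hr, boostFun_apply, h1, h2]
  simp

/-- `o` as an element of the light cone. -/
def oL : LightCone n :=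
  ⟨B.o, by
    refine ⟨fun h => ?_, B.o_o⟩
    have := B.o_ι
    simp [h] at this⟩

/-- The null vector `(r² / 2) o + ι - r τ`. -/
def nullVec (r : ℝ) : LightCone n :=
  ⟨(r ^ 2 / 2) • B.o + B.ι - r • B.τ, by
    constructor
    · intro h
      have h1 : mink n B.o ((r ^ 2 / 2) • B.o + B.ι - r • B.τ) = 0 := by rw [h]; simp
      simp [B.o_o, B.o_ι, B.o_τ] at h1
    · simp only [map_sub, map_add, map_smul, LinearMap.sub_apply, LinearMap.add_apply,
        LinearMap.smul_apply, smul_eq_mul, B.o_o, B.ι_ι, B.o_ι, B.ι_o, B.o_τ, B.ι_τ, B.τ_τ,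
        mink_comm B.τ B.o, mink_comm B.τ B.ι]
      ring⟩

/-- The eigenvector of `(o - τ) ∧ (ι - μ τ)` with eigenvalue `√(1 - 2 μ)`. -/
def vPlus (μ : ℝ) : LightCone n := B.nullVec (1 + √(1 - 2 * μ))

/-- The eigenvector of `(o - τ) ∧ (ι - μ τ)` with eigenvalue `-√(1 - 2 μ)`. -/
def vMinus (μ : ℝ) : LightCone n := B.nullVec (1 - √(1 - 2 * μ))

theorem wedge_nullVec (ζ : ℝ) :
    wedge (B.o - B.τ) (B.ι - ((1 - ζ ^ 2) / 2) • B.τ) (B.nullVec (1 + ζ)) =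
      ζ • (B.nullVec (1 + ζ) : Mink n) := by
  simp only [wedge, rankOne, nullVec, _root_.sub_apply,
    LinearMap.coe_toContinuousLinearMap', LinearMap.smulRight_apply, map_sub, map_add, map_smul,
    LinearMap.sub_apply, LinearMap.smul_apply, smul_eq_mul, B.o_o, B.ι_ι, B.o_ι, B.ι_o, B.o_τ,
    B.ι_τ, B.τ_τ, mink_comm B.τ B.o, mink_comm B.τ B.ι]
  ext i
  simp only [Pi.sub_apply, Pi.add_apply, Pi.smul_apply, smul_eq_mul]
  ring

theorem wedge_vPlus {μ : ℝ} (hμ : 0 ≤ 1 - 2 * μ) :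
    wedge (B.o - B.τ) (B.ι - μ • B.τ) (B.vPlus μ) = √(1 - 2 * μ) • (B.vPlus μ : Mink n) := by
  have h := B.wedge_nullVec (√(1 - 2 * μ))
  rwa [Real.sq_sqrt hμ, show (1 - (1 - 2 * μ)) / 2 = μ by ring] at h

theorem wedge_vMinus {μ : ℝ} (hμ : 0 ≤ 1 - 2 * μ) :
    wedge (B.o - B.τ) (B.ι - μ • B.τ) (B.vMinus μ) = (-√(1 - 2 * μ)) • (B.vMinus μ : Mink n) := by
  have h := B.wedge_nullVec (-√(1 - 2 * μ))
  rwa [neg_sq, Real.sq_sqrt hμ, show (1 - (1 - 2 * μ)) / 2 = μ by ring, ← sub_eq_add_neg] at h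

end PseudoTriple

/-- `s` is a parameter on `(-δ, b)` with `s(0) = 0` in which the polarization `Q(t) dt²` on `(0, b)`
with leading coefficient `q` reads `q ds² / s²`. For `Q(t) = 1 / t²` one can take `s(t) = t`. -/
structure IsPolarParameter (Q : ℝ → ℝ) (q δ b : ℝ) (s : ℝ → ℝ) : Prop where
  smooth : ContDiffOn ℝ ∞ s (Ioo (-δ) b)
  zero : s 0 = 0
  deriv_pos : ∀ t ∈ Ioo (-δ) b, 0 < deriv s t
  eq : ∀ t ∈ Ioo 0 b, Q t = q * deriv s t ^ 2 / s t ^ 2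

/-- `F` is a smooth frame along `⟨c⟩` on `I`, mapping the pseudo-orthonormal basis
`o, ι, τ, n₁, …` to `f, f̄, df/ds, N₁, …`, where
* `f = F o` is the lift of `⟨c⟩` with `‖df/ds‖ = 1`, and `F τ = df/ds`;
* the normal fields `N = F x`, for constant `x` orthogonal to `o, ι, τ`, are parallel and satisfy
  `⟪dN, df⟫ = 0`. -/
structure IsFrame {n : ℕ} (B : PseudoTriple n) (c : ℝ → LightCone n) (s : ℝ → ℝ) (I : Set ℝ)
    (F : ℝ → Lorentz n) : Prop where
  smooth : ContDiffOn ℝ ∞ (fun t => (F t).toEnd) I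
  lift : ∀ t ∈ I, (F t).act B.oL.span = (c t).span
  tangent : ∀ t ∈ I, deriv (fun u => (F u).toEnd B.o) t = deriv s t • (F t).toEnd B.τ
  normal_tangent : ∀ t ∈ I, ∀ x : Mink n, mink n B.o x = 0 → mink n B.ι x = 0 → mink n B.τ x = 0 →
    mink n (deriv (fun u => (F u).toEnd x) t) ((F t).toEnd B.τ) = 0
  normal_parallel : ∀ t ∈ I, ∀ x y : Mink n,
    mink n B.o x = 0 → mink n B.ι x = 0 → mink n B.τ x = 0 →
    mink n B.o y = 0 → mink n B.ι y = 0 → mink n B.τ y = 0 →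
    mink n (deriv (fun u => (F u).toEnd x) t) ((F t).toEnd y) = 0

/-- The singular gauge transformation `g = F R`, where `R = R(t)` satisfies `R o = o / s(t)`,
`R ι = s(t) ι` and is the identity on the orthogonal complement of `o, ι`. -/
def singularGauge {n : ℕ} (B : PseudoTriple n) (s : ℝ → ℝ) (F : ℝ → Lorentz n) (t : ℝ) :
    Lorentz n :=
  F t * B.boost (s t)

end Moebius

end

namespace Moebius

section LeftBounds

variable {E : Type*} [NormedAddCommGroup E] [NormedSpace ℝ E]

theorem norm_le_of_deriv_lt_neg_deriv {f f' : ℝ → E} {B B' : ℝ → ℝ} {a c : ℝ} (hac : a ≤ c)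
    (hf : ∀ x ∈ Icc a c, HasDerivAt f (f' x) x) (hB : ∀ x ∈ Icc a c, HasDerivAt B (B' x) x)
    (h0 : ‖f c‖ ≤ B c) (bound : ∀ x ∈ Icc a c, ‖f x‖ = B x → ‖f' x‖ < -B' x) :
    ‖f a‖ ≤ B a := by
  have hn : ∀ x ∈ Icc (-c) (-a), -x ∈ Icc a c := fun x hx => ⟨by linarith [hx.2], by linarith [hx.1]⟩
  have hf1 : ∀ x ∈ Icc (-c) (-a), HasDerivAt (fun y => f (-y)) (-f' (-x)) x := by
    intro x hx
    have := (hf (-x) (hn x hx)).scomp x (hasDerivAt_neg x)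
    simpa [Function.comp_def] using this
  have hB1 : ∀ x ∈ Icc (-c) (-a), HasDerivAt (fun y => B (-y)) (-B' (-x)) x := by
    intro x hx
    have := (hB (-x) (hn x hx)).scomp x (hasDerivAt_neg x)
    simpa [Function.comp_def] using this
  have := image_norm_le_of_norm_deriv_right_lt_deriv_boundary' (f := fun y => f (-y))
    (f' := fun x => -f' (-x)) (a := -c) (b := -a) (B := fun y => B (-y)) (B' := fun x => -B' (-x))
    (fun x hx => (hf1 x hx).continuousAt.continuousWithinAt)
    (fun x hx => (hf1 x (Ico_subset_Icc_self hx)).hasDerivWithinAt) (by simpa using h0)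
    (fun x hx => (hB1 x hx).continuousAt.continuousWithinAt)
    (fun x hx => (hB1 x (Ico_subset_Icc_self hx)).hasDerivWithinAt)
    (fun x hx h => by
      rw [norm_neg]
      exact bound _ (hn x (Ico_subset_Icc_self hx)) h)
    (x := -a) ⟨by linarith, le_refl _⟩
  simpa using this

theorem norm_sub_le_of_deriv_le_neg_deriv {f f' : ℝ → E} {B B' : ℝ → ℝ} {a c : ℝ} (hac : a ≤ c)
    (hf : ∀ x ∈ Icc a c, HasDerivAt f (f' x) x) (hB : ∀ x ∈ Icc a c, HasDerivAt B (B' x) x)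
    (bound : ∀ x ∈ Icc a c, ‖f' x‖ ≤ -B' x) :
    ‖f a - f c‖ ≤ B a - B c := by
  refine le_of_forall_pos_le_add fun e he => ?_
  have h := norm_le_of_deriv_lt_neg_deriv (f := fun x => f x - f c) (f' := f')
    (B := fun x => B x - B c + e / (c - a + 1) * (c - x)) (B' := fun x => B' x - e / (c - a + 1)) hac
    (fun x hx => (hf x hx).sub_const _)
    (fun x hx => by
      exact (((hB x hx).sub_const (B c)).add
        (((hasDerivAt_id x).const_sub c).const_mul (e / (c - a + 1)))).congr_deriv (by ring))
    (by simp)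
    (fun x hx _ => by
      have : 0 < e / (c - a + 1) := by apply div_pos he; linarith
      linarith [bound x hx])
  have h2 : e / (c - a + 1) * (c - a) ≤ e := by
    rw [div_mul_eq_mul_div, div_le_iff₀ (by linarith)]
    nlinarith
  linarith

theorem exists_tendsto_of_deriv_le [CompleteSpace E] {f f' : ℝ → E} {B B' : ℝ → ℝ} {c l : ℝ}
    (hc : 0 < c) (hf : ∀ x ∈ Ioo 0 c, HasDerivAt f (f' x) x)
    (hB : ∀ x ∈ Ioo 0 c, HasDerivAt B (B' x) x)
    (bound : ∀ x ∈ Ioo 0 c, ‖f' x‖ ≤ -B' x) (hl : Tendsto B (𝓝[>] 0) (𝓝 l)) :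
    ∃ y, Tendsto f (𝓝[>] 0) (𝓝 y) := by
  apply cauchy_map_iff_exists_tendsto.1
  rw [Metric.cauchy_iff]
  refine ⟨inferInstance, fun e he => ?_⟩
  have h1 : ∀ᶠ t in 𝓝[>] (0 : ℝ), dist (B t) l < e / 2 ∧ t ∈ Ioo 0 c :=
    (hl.eventually (Metric.ball_mem_nhds _ (half_pos he))).and (Ioo_mem_nhdsGT hc)
  refine ⟨f '' {t | dist (B t) l < e / 2 ∧ t ∈ Ioo 0 c}, image_mem_map h1, ?_⟩
  have key : ∀ x y, x ∈ {t | dist (B t) l < e / 2 ∧ t ∈ Ioo 0 c} →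
      y ∈ {t | dist (B t) l < e / 2 ∧ t ∈ Ioo 0 c} → x ≤ y → dist (f x) (f y) < e := by
    rintro x y ⟨hx, hx'⟩ ⟨hy, hy'⟩ hxy
    have hs : ∀ z ∈ Icc x y, z ∈ Ioo 0 c := fun z hz => ⟨hx'.1.trans_le hz.1, hz.2.trans_lt hy'.2⟩
    have := norm_sub_le_of_deriv_le_neg_deriv hxy (fun z hz => hf z (hs z hz))
      (fun z hz => hB z (hs z hz)) (fun z hz => bound z (hs z hz))
    rw [dist_eq_norm]
    rw [Real.dist_eq, abs_lt] at hx hy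
    linarith [hx.1, hx.2, hy.1, hy.2]
  rintro _ ⟨x, hx, rfl⟩ _ ⟨y, hy, rfl⟩
  rcases le_total x y with h | h
  · exact key x y hx hy h
  · rw [dist_comm]; exact key y x hy hx h

/-- A vector valued version of l'Hôpital's rule. -/
theorem tendsto_inv_smul_of_deriv {f f' : ℝ → E} {φ φ' : ℝ → ℝ} {c : ℝ} {L : E}
    (hc : 0 < c) (hf : ∀ x ∈ Ioo 0 c, HasDerivAt f (f' x) x)
    (hφ : ∀ x ∈ Ioo 0 c, HasDerivAt φ (φ' x) x) (hφ' : ∀ x ∈ Ioo 0 c, φ' x < 0)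
    (hφt : Tendsto φ (𝓝[>] 0) atTop)
    (hL : Tendsto (fun t => (φ' t)⁻¹ • f' t) (𝓝[>] 0) (𝓝 L)) :
    Tendsto (fun t => (φ t)⁻¹ • f t) (𝓝[>] 0) (𝓝 L) := by
  rw [Metric.tendsto_nhds]
  intro e he
  have h1 : ∀ᶠ t in 𝓝[>] (0 : ℝ), dist ((φ' t)⁻¹ • f' t) L < e / 4 ∧ t ∈ Ioo 0 c :=
    (hL.eventually (Metric.ball_mem_nhds _ (by positivity))).and (Ioo_mem_nhdsGT hc)
  obtain ⟨u, hu, hsub⟩ := mem_nhdsGT_iff_exists_Ioo_subset.1 h1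
  have hu0 : (0 : ℝ) < u := hu
  have hy : u / 2 ∈ Ioo 0 u := ⟨by linarith, by linarith⟩
  set y := u / 2 with hydef
  have key : ∀ x ∈ Ioo 0 y, ‖f x - φ x • L - (f y - φ y • L)‖ ≤ e / 4 * φ x - e / 4 * φ y := by
    intro x hx
    have hs : ∀ z ∈ Icc x y, z ∈ Ioo 0 u := fun z hz => ⟨hx.1.trans_le hz.1, hz.2.trans_lt hy.2⟩
    refine norm_sub_le_of_deriv_le_neg_deriv (f := fun x => f x - φ x • L)
      (B := fun x => e / 4 * φ x) hx.2.le
      (fun z hz => (hf z (hsub (hs z hz)).2).sub ((hφ z (hsub (hs z hz)).2).smul_const L))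
      (fun z hz => (hφ z (hsub (hs z hz)).2).const_mul _) ?_
    intro z hz
    obtain ⟨hz1, hz2⟩ := hsub (hs z hz)
    have hneg := hφ' z hz2
    have : f' z - φ' z • L = φ' z • ((φ' z)⁻¹ • f' z - L) := by
      rw [smul_sub, smul_smul, mul_inv_cancel₀ hneg.ne, one_smul]
    rw [this, norm_smul, Real.norm_eq_abs, abs_of_neg hneg]
    rw [dist_eq_norm] at hz1
    nlinarith
  filter_upwards [hφt.eventually_gt_atTop (max 1 (max (φ y) (4 * (‖f y - φ y • L‖ + e / 4 * |φ y|) / e))),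
    Ioo_mem_nhdsGT hy.1] with x hx hxy
  have hx1 : 1 < φ x := (le_max_left _ _).trans_lt hx
  have hx2 : 4 * (‖f y - φ y • L‖ + e / 4 * |φ y|) / e < φ x :=
    ((le_max_right _ _).trans (le_max_right _ _)).trans_lt hx
  rw [div_lt_iff₀ he] at hx2
  have hk := key x hxy
  have h3 : ‖f x - φ x • L‖ ≤ e / 4 * φ x + e / 4 * |φ y| + ‖f y - φ y • L‖ := by
    have := norm_sub_norm_le (f x - φ x • L) (f y - φ y • L)
    nlinarith [neg_abs_le (φ y)]
  have h4 : (φ x)⁻¹ • f x - L = (φ x)⁻¹ • (f x - φ x • L) := by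
    rw [smul_sub, smul_smul, inv_mul_cancel₀ (by linarith), one_smul]
  rw [dist_eq_norm, h4, norm_smul, norm_inv, Real.norm_eq_abs, abs_of_pos (by linarith),
    inv_mul_lt_iff₀ (by linarith)]
  nlinarith [mul_pos he (by linarith : 0 < φ x)]

end LeftBounds

/-- Comparison functions for the growth of the solutions of a singular linear equation. -/
theorem exists_growth_functions {ζ : ℝ} (hζ : 0 ≤ ζ) : ∃ φ₁ φ₂ : ℝ → ℝ, ∃ a > 0,
    (∀ t ∈ Ioo (0 : ℝ) 1, HasDerivAt φ₁ (-t ^ (-(2 * ζ) - 1)) t) ∧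
    (∀ t ∈ Ioo (0 : ℝ) 1, HasDerivAt φ₂ (-(t ^ (ζ - 1) * φ₁ t)) t) ∧
    (∀ᶠ t in 𝓝[>] (0 : ℝ), a ≤ t ^ (2 * ζ) * φ₁ t) ∧
    (∀ t ∈ Ioo (0 : ℝ) 1, 0 < φ₁ t) ∧
    Tendsto φ₁ (𝓝[>] 0) atTop ∧ Tendsto φ₂ (𝓝[>] 0) atTop := by
  rcases hζ.eq_or_lt with rfl | hζ
  · have hlog : Tendsto (fun t => -Real.log t) (𝓝[>] 0) atTop :=
      tendsto_neg_atBot_atTop.comp Real.tendsto_log_nhdsGT_zero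
    refine ⟨fun t => -Real.log t, fun t => (Real.log t) ^ 2 / 2, 1, one_pos, ?_, ?_, ?_, ?_, hlog, ?_⟩
    · intro t ht
      exact (Real.hasDerivAt_log ht.1.ne').neg.congr_deriv (by simp [Real.rpow_neg_one])
    · intro t ht
      exact (((Real.hasDerivAt_log ht.1.ne').pow 2).div_const 2).congr_deriv
        (by simp [Real.rpow_neg_one]; ring)
    · filter_upwards [hlog.eventually_ge_atTop 1] with t ht
      simpa using ht
    · intro t ht
      have := Real.log_neg ht.1 ht.2
      linarith
    · have := (hlog.atTop_mul_atTop₀ hlog).atTop_div_const (r := 2) two_pos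
      refine this.congr fun t => ?_
      ring
  · have hr : ∀ a : ℝ, 0 < a → Tendsto (fun t : ℝ => t ^ (-a)) (𝓝[>] 0) atTop := fun a ha =>
      tendsto_rpow_neg_nhdsGT_zero (by linarith)
    refine ⟨fun t => t ^ (-(2 * ζ)) / (2 * ζ), fun t => t ^ (-ζ) / (2 * ζ ^ 2), 1 / (2 * ζ),
      by positivity, ?_, ?_, ?_, ?_, (hr _ (by positivity)).atTop_div_const (by positivity),
      (hr _ hζ).atTop_div_const (by positivity)⟩
    · intro t ht
      exact ((Real.hasDerivAt_rpow_const (p := -(2 * ζ)) (Or.inl ht.1.ne')).div_const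
        (2 * ζ)).congr_deriv (by field_simp)
    · intro t ht
      refine ((Real.hasDerivAt_rpow_const (p := -ζ) (Or.inl ht.1.ne')).div_const
        (2 * ζ ^ 2)).congr_deriv ?_
      have : t ^ (-ζ - 1) = t ^ (ζ - 1) * t ^ (-(2 * ζ)) := by
        rw [← Real.rpow_add ht.1]; congr 1; ring
      rw [this]
      field_simp
    · filter_upwards [self_mem_nhdsWithin] with t ht
      rw [Real.rpow_neg (le_of_lt ht)]
      have : 0 < t ^ (2 * ζ) := Real.rpow_pos_of_pos ht _
      field_simp
      exact le_refl _
    · intro t ht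
      have := Real.rpow_pos_of_pos ht.1 (-(2 * ζ))
      positivity

end Moebius

namespace Moebius

section SingularEquation

variable {𝔸 : Type*} [NormedRing 𝔸] [NormedAlgebra ℝ 𝔸]

/-- Growth of the solutions of `G' = G ψ`, where `ψ(t) + Y / t` is bounded by `C` near `0`. -/
theorem exists_growth_bound {Y : 𝔸} {ζ : ℝ} (hζ : 0 ≤ ζ)
    (hY : Y * (Y * Y + ζ • Y) = ζ • (Y * Y + ζ • Y)) {ψ : ℝ → 𝔸} {c C : ℝ} (hc : 0 < c)
    (hψ : ∀ t ∈ Ioo 0 c, ‖ψ t + t⁻¹ • Y‖ ≤ C) :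
    ∃ t₀ ∈ Ioo 0 c, ∃ M > 0, ∀ G : ℝ → 𝔸, (∀ t ∈ Ioo 0 c, HasDerivAt G (G t * ψ t) t) →
      ∀ t₁ ∈ Ioc 0 t₀, G t₁ = 1 → ∀ τ ∈ Ioc 0 t₁, ‖G τ‖ ≤ M * (t₁ / τ) ^ (ζ + 1 / 2) := by
  set W := Y * Y + ζ • Y with hW
  have hC : 0 ≤ C := (norm_nonneg _).trans (hψ (c / 2) ⟨by linarith, by linarith⟩)
  set C₁ := C * (1 + 4 * ‖Y‖ + 16 * ‖W‖) with hC₁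
  have hC₁0 : 0 ≤ C₁ := by positivity
  set N : ℝ := ‖(1 : 𝔸)‖ + ‖Y‖ + ‖W‖ + 1 with hN
  have hN0 : 0 < N := by positivity
  set t₀ := min (c / 2) (1 / (8 * (C₁ + 1))) with ht₀
  refine ⟨t₀, ⟨by positivity, (min_le_left _ _).trans_lt (by linarith)⟩, 16 * N, by positivity,
    fun G hG t₁ ht₁ h1 τ hτ => ?_⟩
  have htc : t₁ < c := ht₁.2.trans_lt ((min_le_left _ _).trans_lt (by linarith))
  have hsub : ∀ x ∈ Icc τ t₁, x ∈ Ioo 0 c := fun x hx => ⟨hτ.1.trans_le hx.1, hx.2.trans_lt htc⟩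
  set D : ℝ → 𝔸 := fun t => ψ t + t⁻¹ • Y with hD
  have hψD : ∀ t, ψ t = D t - t⁻¹ • Y := fun t => by simp [hD]
  set κ := ζ + 1 / 2 with hκ
  set f : ℝ → 𝔸 × 𝔸 × 𝔸 := fun t => ((1 / 16 : ℝ) • G t, (1 / 4 : ℝ) • (G t * Y), G t * W) with hf
  have key : ‖f τ‖ ≤ N * t₁ ^ κ * τ ^ (-κ) := by
    refine norm_le_of_deriv_lt_neg_deriv
      (f' := fun t => ((1 / 16 : ℝ) • (G t * ψ t), (1 / 4 : ℝ) • (G t * ψ t * Y), G t * ψ t * W))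
      (B := fun t => N * t₁ ^ κ * t ^ (-κ)) hτ.2 (fun x hx => ?_)
      (fun x hx => (Real.hasDerivAt_rpow_const (Or.inl (hsub x hx).1.ne')).const_mul _) ?_ ?_
    · have := hG x (hsub x hx)
      exact (this.const_smul (1 / 16 : ℝ)).prodMk
        (((this.mul_const Y).const_smul (1 / 4 : ℝ)).prodMk (this.mul_const W))
    · rw [mul_assoc, ← Real.rpow_add ht₁.1, add_neg_cancel, Real.rpow_zero, mul_one]
      simp only [hf, h1, one_mul, Prod.norm_def, norm_smul]
      norm_num
      refine ⟨?_, ?_, ?_⟩ <;> rw [hN] <;> linarith [norm_nonneg (1 : 𝔸), norm_nonneg Y, norm_nonneg W]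
    · intro x hx hfx
      have hx0 : 0 < x := (hsub x hx).1
      have hpos : 0 < ‖f x‖ := by
        rw [hfx]
        exact mul_pos (mul_pos hN0 (Real.rpow_pos_of_pos ht₁.1 _)) (Real.rpow_pos_of_pos hx0 _)
      have hrhs : -(N * t₁ ^ κ * (-κ * x ^ (-κ - 1))) = κ * x⁻¹ * ‖f x‖ := by
        rw [hfx, Real.rpow_sub hx0, Real.rpow_one]
        field_simp
      rw [hrhs]
      have hxC : C₁ < 1 / 8 * x⁻¹ := by
        have : x ≤ 1 / (8 * (C₁ + 1)) := hx.2.trans (ht₁.2.trans (min_le_right _ _))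
        rw [le_div_iff₀ (by positivity)] at this
        rw [← div_eq_mul_inv, lt_div_iff₀ hx0]
        nlinarith
      have hA : ‖G x‖ ≤ 16 * ‖f x‖ := by
        have : ‖(1 / 16 : ℝ) • G x‖ ≤ ‖f x‖ := norm_fst_le (f x)
        rw [norm_smul] at this
        norm_num at this
        linarith
      have hB : ‖G x * Y‖ ≤ 4 * ‖f x‖ := by
        have : ‖(1 / 4 : ℝ) • (G x * Y)‖ ≤ ‖f x‖ := (norm_fst_le (f x).2).trans (norm_snd_le (f x))
        rw [norm_smul] at this
        norm_num at this
        linarith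
      have hH : ‖G x * W‖ ≤ ‖f x‖ := (norm_snd_le (f x).2).trans (norm_snd_le (f x))
      have hDx : ‖D x‖ ≤ C := hψ x (hsub x hx)
      have hGD : ‖G x * D x‖ ≤ 16 * ‖f x‖ * C :=
        (norm_mul_le _ _).trans (mul_le_mul hA hDx (norm_nonneg _) (by positivity))
      have hGDY : ‖G x * D x * Y‖ ≤ 16 * ‖f x‖ * C * ‖Y‖ :=
        (norm_mul_le _ _).trans (mul_le_mul_of_nonneg_right hGD (norm_nonneg _))
      have hGDW : ‖G x * D x * W‖ ≤ 16 * ‖f x‖ * C * ‖W‖ :=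
        (norm_mul_le _ _).trans (mul_le_mul_of_nonneg_right hGD (norm_nonneg _))
      have hxi : 0 < x⁻¹ := inv_pos.2 hx0
      have hCf : 0 ≤ ‖f x‖ * C := by positivity
      have hCY : 0 ≤ ‖f x‖ * C * ‖Y‖ := by positivity
      have hCW : 0 ≤ ‖f x‖ * C * ‖W‖ := by positivity
      have hCx : C₁ * ‖f x‖ < 1 / 8 * x⁻¹ * ‖f x‖ := mul_lt_mul_of_pos_right hxC hpos
      have hxf : 0 < x⁻¹ * ‖f x‖ := by positivity
      have hζx : 0 ≤ ζ * (x⁻¹ * ‖f x‖) := by positivity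
      have e1 : G x * ψ x = G x * D x - x⁻¹ • (G x * Y) := by
        rw [hψD, mul_sub, mul_smul_comm]
      have e2 : G x * ψ x * Y = G x * D x * Y - x⁻¹ • (G x * W - ζ • (G x * Y)) := by
        have : Y * Y = W - ζ • Y := by rw [hW]; abel
        rw [e1, sub_mul, smul_mul_assoc, mul_assoc (G x) Y Y, this, mul_sub, mul_smul_comm]
      have e3 : G x * ψ x * W = G x * D x * W - x⁻¹ • (ζ • (G x * W)) := by
        rw [e1, sub_mul, smul_mul_assoc, mul_assoc (G x) Y W, hY, mul_smul_comm]
      rw [hC₁] at hCx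
      refine max_lt ?_ (max_lt ?_ ?_)
      · simp only [e1]
        rw [norm_smul]
        norm_num
        have : ‖G x * D x - x⁻¹ • (G x * Y)‖ ≤ 16 * ‖f x‖ * C + x⁻¹ * (4 * ‖f x‖) := by
          refine (norm_sub_le _ _).trans (add_le_add hGD ?_)
          rw [norm_smul, Real.norm_eq_abs, abs_of_pos hxi]
          exact mul_le_mul_of_nonneg_left hB hxi.le
        rw [hκ]
        linarith
      · simp only [e2]
        rw [norm_smul]
        norm_num
        have : ‖G x * D x * Y - x⁻¹ • (G x * W - ζ • (G x * Y))‖ ≤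
            16 * ‖f x‖ * C * ‖Y‖ + x⁻¹ * (‖f x‖ + ζ * (4 * ‖f x‖)) := by
          refine (norm_sub_le _ _).trans (add_le_add hGDY ?_)
          rw [norm_smul, Real.norm_eq_abs, abs_of_pos hxi]
          refine mul_le_mul_of_nonneg_left ((norm_sub_le _ _).trans (add_le_add hH ?_)) hxi.le
          rw [norm_smul, Real.norm_eq_abs, abs_of_nonneg hζ]
          exact mul_le_mul_of_nonneg_left hB hζ
        rw [hκ]
        linarith
      · simp only [e3]
        have : ‖G x * D x * W - x⁻¹ • (ζ • (G x * W))‖ ≤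
            16 * ‖f x‖ * C * ‖W‖ + x⁻¹ * (ζ * ‖f x‖) := by
          refine (norm_sub_le _ _).trans (add_le_add hGDW ?_)
          rw [norm_smul, Real.norm_eq_abs, abs_of_pos hxi, norm_smul, Real.norm_eq_abs,
            abs_of_nonneg hζ]
          exact mul_le_mul_of_nonneg_left (mul_le_mul_of_nonneg_left hH hζ) hxi.le
        rw [hκ]
        linarith
  have hA : ‖G τ‖ ≤ 16 * ‖f τ‖ := by
    have : ‖(1 / 16 : ℝ) • G τ‖ ≤ ‖f τ‖ := norm_fst_le (f τ)
    rw [norm_smul] at this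
    norm_num at this
    linarith
  rw [Real.div_rpow ht₁.1.le hτ.1.le, div_eq_mul_inv, ← Real.rpow_neg hτ.1.le]
  linarith

/-- Asymptotics at `0` of the solutions of `G' = G ψ`, where `ψ(t) + Y / t` is bounded. -/
theorem exists_singular_asymptotics [CompleteSpace 𝔸] {Y : 𝔸} {ζ : ℝ} (hζ : 0 ≤ ζ)
    (hY : Y * (Y * Y + ζ • Y) = ζ • (Y * Y + ζ • Y)) {ψ : ℝ → 𝔸}
    (hψ : (fun t => ψ t + t⁻¹ • Y) =O[𝓝[>] 0] (fun _ => (1 : ℝ)))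
    {b : ℝ} (hb : 0 < b) {G : ℝ → 𝔸ˣ}
    (hG : ∀ t ∈ Ioo 0 b, HasDerivAt (fun τ => (G τ : 𝔸)) (G t * ψ t) t) :
    ∃ K : 𝔸, Tendsto (fun t => t ^ ζ • (G t * (Y * Y + ζ • Y))) (𝓝[>] 0) (𝓝 K) ∧
      Tendsto (fun t => t ^ (-ζ) • (((G t)⁻¹ : 𝔸ˣ) * K)) (𝓝[>] 0) (𝓝 (Y * Y + ζ • Y)) ∧
      ∃ φ : ℝ → ℝ, Tendsto φ (𝓝[>] 0) atTop ∧
        Tendsto (fun t => (φ t)⁻¹ • (G t : 𝔸)) (𝓝[>] 0) (𝓝 K) := by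
  set W := Y * Y + ζ • Y with hW
  obtain ⟨C, hC⟩ := hψ.bound
  have h1 : ∀ᶠ t in 𝓝[>] (0 : ℝ), ‖ψ t + t⁻¹ • Y‖ ≤ C ∧ t ∈ Ioo 0 (min b 1) := by
    refine (hC.mono fun t ht => ?_).and (Ioo_mem_nhdsGT (by positivity))
    simpa using ht
  obtain ⟨c, hc0, hsub⟩ := mem_nhdsGT_iff_exists_Ioo_subset.1 h1
  replace hc0 : 0 < c := hc0
  have hψc : ∀ t ∈ Ioo 0 c, ‖ψ t + t⁻¹ • Y‖ ≤ C := fun t ht => (hsub ht).1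
  have hGc : ∀ t ∈ Ioo 0 c, HasDerivAt (fun τ => (G τ : 𝔸)) (G t * ψ t) t :=
    fun t ht => hG t ⟨ht.1, (hsub ht).2.2.trans_le (min_le_left _ _)⟩
  have hc1 : ∀ t ∈ Ioo 0 c, t ∈ Ioo (0 : ℝ) 1 :=
    fun t ht => ⟨ht.1, (hsub ht).2.2.trans_le (min_le_right _ _)⟩
  have hC0 : 0 ≤ C := (norm_nonneg _).trans (hψc (c / 2) ⟨by linarith, by linarith⟩)
  obtain ⟨t₀, ht₀, M, hM, hbound⟩ := exists_growth_bound hζ hY hc0 hψc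
  set D : ℝ → 𝔸 := fun t => ψ t + t⁻¹ • Y with hD
  have hψD : ∀ t, ψ t = D t - t⁻¹ • Y := fun t => by simp [hD]
  -- the solutions normalized at `t₁`
  have hbd : ∀ t₁ ∈ Ioc 0 t₀, ∀ τ ∈ Ioc 0 t₁,
      ‖(((G t₁)⁻¹ : 𝔸ˣ) * G τ : 𝔸)‖ ≤ M * (t₁ / τ) ^ (ζ + 1 / 2) := by
    intro t₁ ht₁ τ hτ
    refine hbound (fun τ => ((G t₁)⁻¹ : 𝔸ˣ) * G τ) (fun t ht => ?_) t₁ ht₁ (by simp) τ hτ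
    exact ((hGc t ht).const_mul _).congr_deriv (mul_assoc _ _ _).symm
  have hder : ∀ t ∈ Ioo 0 c, HasDerivAt (fun τ => τ ^ ζ • ((G τ : 𝔸) * W))
      (t ^ ζ • (G t * D t * W)) t := by
    intro t ht
    refine ((Real.hasDerivAt_rpow_const (Or.inl ht.1.ne')).smul
      ((hGc t ht).mul_const W)).congr_deriv ?_
    have : t ^ (ζ - 1) = t ^ ζ * t⁻¹ := by rw [Real.rpow_sub ht.1, Real.rpow_one]; rfl
    rw [hψD, mul_sub, sub_mul, mul_smul_comm, smul_mul_assoc, mul_assoc _ Y W, hY, mul_smul_comm,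
      smul_sub, this]
    module
  have hBder : ∀ (a : ℝ) {t : ℝ}, 0 < t →
      HasDerivAt (fun τ : ℝ => -(a * (2 * τ ^ (1 / 2 : ℝ)))) (-(a * t ^ (-(1 / 2) : ℝ))) t := by
    intro a t ht
    refine (((Real.hasDerivAt_rpow_const (p := 1 / 2) (Or.inl ht.ne')).const_mul 2).const_mul
      a).neg.congr_deriv ?_
    norm_num
    left
    ring
  have hpow : ∀ t₁ > (0 : ℝ), ∀ τ > (0 : ℝ), τ ^ ζ * (t₁ / τ) ^ (ζ + 1 / 2) =
      t₁ ^ (ζ + 1 / 2) * τ ^ (-(1 / 2) : ℝ) := by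
    intro t₁ ht₁ τ hτ
    rw [Real.div_rpow ht₁.le hτ.le, div_eq_mul_inv, ← Real.rpow_neg hτ.le, mul_left_comm,
      ← Real.rpow_add hτ]
    congr 2
    ring
  have hderbd : ∀ t₁ ∈ Ioc 0 t₀, ∀ τ ∈ Ioc 0 t₁,
      ‖((G t₁)⁻¹ : 𝔸ˣ) * (τ ^ ζ • (G τ * D τ * W))‖ ≤
        M * C * ‖W‖ * t₁ ^ (ζ + 1 / 2) * τ ^ (-(1 / 2) : ℝ) := by
    intro t₁ ht₁ τ hτ
    rw [mul_smul_comm, norm_smul, Real.norm_eq_abs, abs_of_pos (Real.rpow_pos_of_pos hτ.1 _),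
      ← mul_assoc, ← mul_assoc]
    have hτc : τ ∈ Ioo 0 c := ⟨hτ.1, (hτ.2.trans ht₁.2).trans_lt ht₀.2⟩
    calc _ ≤ τ ^ ζ * (M * (t₁ / τ) ^ (ζ + 1 / 2) * C * ‖W‖) := by
          refine mul_le_mul_of_nonneg_left ?_ (Real.rpow_nonneg hτ.1.le _)
          refine (norm_mul_le _ _).trans (mul_le_mul_of_nonneg_right ?_ (norm_nonneg _))
          refine (norm_mul_le _ _).trans (mul_le_mul (hbd t₁ ht₁ τ hτ) (hψc τ hτc)
            (norm_nonneg _) ?_)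
          exact mul_nonneg hM.le (Real.rpow_nonneg (div_nonneg ht₁.1.le hτ.1.le) _)
      _ = M * C * ‖W‖ * (τ ^ ζ * (t₁ / τ) ^ (ζ + 1 / 2)) := by ring
      _ = _ := by rw [hpow t₁ ht₁.1 τ hτ.1]; ring
  have ht₀' : t₀ ∈ Ioc 0 t₀ := ⟨ht₀.1, le_refl _⟩
  have hnbd : ∀ t₁ ∈ Ioc 0 t₀, ∃ y, Tendsto
      (fun τ => ((G t₁)⁻¹ : 𝔸ˣ) * (τ ^ ζ • ((G τ : 𝔸) * W))) (𝓝[>] 0) (𝓝 y) := by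
    intro t₁ ht₁
    have hlt : ∀ x ∈ Ioo 0 t₁, x ∈ Ioo 0 c := fun x hx => ⟨hx.1, hx.2.trans (ht₁.2.trans_lt ht₀.2)⟩
    refine exists_tendsto_of_deriv_le (c := t₁)
      (B := fun τ => -(M * C * ‖W‖ * t₁ ^ (ζ + 1 / 2) * (2 * τ ^ (1 / 2 : ℝ)))) (l := 0) ht₁.1
      (fun x hx => (hder x (hlt x hx)).const_mul _) (fun x hx => hBder _ hx.1) ?_ ?_
    · intro x hx
      rw [neg_neg]
      exact hderbd t₁ ht₁ x (Ioo_subset_Ioc_self hx)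
    · have : Tendsto (fun τ : ℝ => τ ^ (1 / 2 : ℝ)) (𝓝[>] 0) (𝓝 0) := by
        have := (Real.continuousAt_rpow_const (0 : ℝ) (1 / 2) (Or.inr (by norm_num))).tendsto
        rw [Real.zero_rpow (by norm_num)] at this
        exact this.mono_left nhdsWithin_le_nhds
      simpa using ((this.const_mul 2).const_mul (M * C * ‖W‖ * t₁ ^ (ζ + 1 / 2))).neg
  obtain ⟨K, hK⟩ : ∃ K, Tendsto (fun t => t ^ ζ • ((G t : 𝔸) * W)) (𝓝[>] 0) (𝓝 K) := by
    obtain ⟨y, hy⟩ := hnbd t₀ ht₀'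
    refine ⟨G t₀ * y, (hy.const_mul (G t₀ : 𝔸)).congr fun t => ?_⟩
    rw [Units.mul_inv_cancel_left]
  refine ⟨K, hK, ?_, ?_⟩
  · have hest : ∀ t₁ ∈ Ioc 0 t₀, ‖t₁ ^ (-ζ) • (((G t₁)⁻¹ : 𝔸ˣ) * K) - W‖ ≤
        2 * (M * C * ‖W‖) * t₁ := by
      intro t₁ ht₁
      have h2 : ‖((G t₁)⁻¹ : 𝔸ˣ) * K - t₁ ^ ζ • W‖ ≤
          M * C * ‖W‖ * t₁ ^ (ζ + 1 / 2) * (2 * t₁ ^ (1 / 2 : ℝ)) := by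
        refine le_of_tendsto ((hK.const_mul (((G t₁)⁻¹ : 𝔸ˣ) : 𝔸)).sub_const _).norm ?_
        filter_upwards [Ioo_mem_nhdsGT ht₁.1] with τ hτ
        have hlt : ∀ x ∈ Icc τ t₁, x ∈ Ioc 0 t₁ := fun x hx => ⟨hτ.1.trans_le hx.1, hx.2⟩
        have h3 := norm_sub_le_of_deriv_le_neg_deriv
          (f := fun τ => ((G t₁)⁻¹ : 𝔸ˣ) * (τ ^ ζ • ((G τ : 𝔸) * W)))
          (B := fun τ => -(M * C * ‖W‖ * t₁ ^ (ζ + 1 / 2) * (2 * τ ^ (1 / 2 : ℝ)))) hτ.2.le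
          (fun x hx => (hder x ⟨(hlt x hx).1, hx.2.trans_lt (ht₁.2.trans_lt ht₀.2)⟩).const_mul _)
          (fun x hx => hBder _ (hlt x hx).1)
          (fun x hx => by rw [neg_neg]; exact hderbd t₁ ht₁ x (hlt x hx))
        have h4 : ((G t₁)⁻¹ : 𝔸ˣ) * (t₁ ^ ζ • ((G t₁ : 𝔸) * W)) = t₁ ^ ζ • W := by
          rw [mul_smul_comm, Units.inv_mul_cancel_left]
        simp only [h4] at h3
        have h5 : 0 ≤ M * C * ‖W‖ * t₁ ^ (ζ + 1 / 2) * (2 * τ ^ (1 / 2 : ℝ)) := by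
          have := Real.rpow_nonneg ht₁.1.le (ζ + 1 / 2)
          have := Real.rpow_nonneg hτ.1.le (1 / 2)
          positivity
        linarith
      have h6 : t₁ ^ (-ζ) • (((G t₁)⁻¹ : 𝔸ˣ) * K) - W =
          t₁ ^ (-ζ) • (((G t₁)⁻¹ : 𝔸ˣ) * K - t₁ ^ ζ • W) := by
        rw [smul_sub, smul_smul, ← Real.rpow_add ht₁.1, neg_add_cancel, Real.rpow_zero, one_smul]
      have hp := Real.rpow_pos_of_pos ht₁.1 (-ζ)
      rw [h6, norm_smul, Real.norm_eq_abs, abs_of_pos hp]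
      refine (mul_le_mul_of_nonneg_left h2 hp.le).trans (le_of_eq ?_)
      have : t₁ ^ (-ζ) * (t₁ ^ (ζ + 1 / 2) * t₁ ^ (1 / 2 : ℝ)) = t₁ := by
        rw [← Real.rpow_add ht₁.1, ← Real.rpow_add ht₁.1]
        rw [show -ζ + (ζ + 1 / 2 + 1 / 2) = 1 by ring, Real.rpow_one]
      linear_combination 2 * (M * C * ‖W‖) * this
    rw [tendsto_iff_norm_sub_tendsto_zero]
    refine squeeze_zero' (Eventually.of_forall fun _ => norm_nonneg _)
      (Filter.mem_of_superset (Ioc_mem_nhdsGT ht₀.1) hest) ?_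
    have : Tendsto (fun t : ℝ => t) (𝓝[>] 0) (𝓝 0) := tendsto_id.mono_left nhdsWithin_le_nhds
    simpa using this.const_mul (2 * (M * C * ‖W‖))
  · obtain ⟨φ₁, φ₂, a, ha, hφ₁, hφ₂, hlow, hpos, hlim₁, hlim₂⟩ := exists_growth_functions hζ
    have hGbd : ∀ t ∈ Ioc 0 t₀, ‖(G t : 𝔸)‖ * t ^ (ζ + 1 / 2) ≤ ‖(G t₀ : 𝔸)‖ * M * t₀ ^ (ζ + 1 / 2) := by
      intro t ht
      have h2 := hbd t₀ ht₀' t ht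
      have h3 : ‖(G t : 𝔸)‖ ≤ ‖(G t₀ : 𝔸)‖ * (M * (t₀ / t) ^ (ζ + 1 / 2)) := by
        calc ‖(G t : 𝔸)‖ = ‖(G t₀ : 𝔸) * (((G t₀)⁻¹ : 𝔸ˣ) * G t)‖ := by
              rw [Units.mul_inv_cancel_left]
          _ ≤ _ := (norm_mul_le _ _).trans (mul_le_mul_of_nonneg_left h2 (norm_nonneg _))
      have hp := Real.rpow_pos_of_pos ht.1 (ζ + 1 / 2)
      rw [Real.div_rpow ht₀.1.le ht.1.le] at h3
      refine (mul_le_mul_of_nonneg_right h3 hp.le).trans (le_of_eq ?_)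
      rw [mul_div_assoc', mul_div_assoc', div_mul_cancel₀ _ hp.ne', mul_assoc]
    set M₀ := ‖(G t₀ : 𝔸)‖ * M * t₀ ^ (ζ + 1 / 2) with hM₀
    have hGD : Tendsto (fun t => t ^ (ζ + 1) • (G t * D t)) (𝓝[>] 0) (𝓝 0) := by
      rw [tendsto_zero_iff_norm_tendsto_zero]
      refine squeeze_zero' (Eventually.of_forall fun _ => norm_nonneg _)
        (g := fun t => M₀ * C * t ^ (1 / 2 : ℝ)) ?_ ?_
      · filter_upwards [Ioc_mem_nhdsGT ht₀.1] with t ht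
        have hp := Real.rpow_pos_of_pos ht.1 (1 / 2)
        have hp' := Real.rpow_pos_of_pos ht.1 (ζ + 1 / 2)
        have he : t ^ (ζ + 1) = t ^ (ζ + 1 / 2) * t ^ (1 / 2 : ℝ) := by
          rw [← Real.rpow_add ht.1]; congr 1; ring
        rw [norm_smul, Real.norm_eq_abs, abs_of_pos (Real.rpow_pos_of_pos ht.1 _), he]
        have hDt : ‖D t‖ ≤ C := hψc t ⟨ht.1, ht.2.trans_lt ht₀.2⟩
        calc _ ≤ t ^ (ζ + 1 / 2) * t ^ (1 / 2 : ℝ) * (‖(G t : 𝔸)‖ * C) := by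
              refine mul_le_mul_of_nonneg_left ((norm_mul_le _ _).trans
                (mul_le_mul_of_nonneg_left hDt (norm_nonneg _))) (by positivity)
          _ = (‖(G t : 𝔸)‖ * t ^ (ζ + 1 / 2)) * C * t ^ (1 / 2 : ℝ) := by ring
          _ ≤ _ := by
              refine mul_le_mul_of_nonneg_right ?_ hp.le
              exact mul_le_mul_of_nonneg_right (hGbd t ht) hC0
      · have := (Real.continuousAt_rpow_const (0 : ℝ) (1 / 2) (Or.inr (by norm_num))).tendsto
        rw [Real.zero_rpow (by norm_num)] at this
        simpa using (this.mono_left nhdsWithin_le_nhds).const_mul (M₀ * C)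
    have hstep₁ : Tendsto (fun t => (φ₁ t)⁻¹ • (t ^ (-ζ) • ((G t : 𝔸) * Y))) (𝓝[>] 0) (𝓝 K) := by
      refine tendsto_inv_smul_of_deriv hc0
        (f' := fun t => (-t ^ (-(2 * ζ) - 1)) • (t ^ ζ • ((G t : 𝔸) * W) - t ^ (ζ + 1) • (G t * D t) * Y))
        (fun t ht => ?_) (fun t ht => hφ₁ t (hc1 t ht))
        (fun t ht => neg_lt_zero.2 (Real.rpow_pos_of_pos ht.1 _)) hlim₁ ?_
      · refine ((Real.hasDerivAt_rpow_const (Or.inl ht.1.ne')).smul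
          ((hGc t ht).mul_const Y)).congr_deriv ?_
        have e1 : t ^ (-ζ - 1) = t ^ (-ζ) * t⁻¹ := by
          rw [Real.rpow_sub ht.1, Real.rpow_one]; rfl
        have e2 : t ^ (-(2 * ζ) - 1) * t ^ ζ = t ^ (-ζ) * t⁻¹ := by
          rw [← e1, ← Real.rpow_add ht.1]; congr 1; ring
        have e3 : t ^ (-(2 * ζ) - 1) * t ^ (ζ + 1) = t ^ (-ζ) := by
          rw [← Real.rpow_add ht.1]; congr 1; ring
        rw [hψD, smul_sub, smul_mul_assoc, smul_smul, smul_smul, neg_mul _ (t ^ ζ),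
          neg_mul _ (t ^ (ζ + 1)), e2, e3, e1, hW]
        simp only [mul_add, mul_sub, sub_mul, mul_smul_comm, smul_mul_assoc, mul_assoc]
        module
      · have := hK.sub (hGD.mul_const Y)
        rw [zero_mul, sub_zero] at this
        refine this.congr' ?_
        filter_upwards [self_mem_nhdsWithin] with t ht
        have : t ^ (-(2 * ζ) - 1) ≠ 0 := (Real.rpow_pos_of_pos ht _).ne'
        rw [smul_smul, inv_mul_cancel₀ (neg_ne_zero.2 this), one_smul]
    refine ⟨φ₂, hlim₂, ?_⟩
    refine tendsto_inv_smul_of_deriv hc0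
      (fun t ht => hGc t ht) (fun t ht => hφ₂ t (hc1 t ht)) (fun t ht => neg_lt_zero.2
        (mul_pos (Real.rpow_pos_of_pos ht.1 _) (hpos t (hc1 t ht)))) hlim₂ ?_
    have hsmall : Tendsto (fun t => (t ^ (2 * ζ) * φ₁ t)⁻¹ • (t ^ (ζ + 1) • (G t * D t)))
        (𝓝[>] 0) (𝓝 0) := by
      have hb : ∀ᶠ t in 𝓝[>] (0 : ℝ), ‖(t ^ (2 * ζ) * φ₁ t)⁻¹‖ ≤ a⁻¹ := by
        filter_upwards [hlow] with t ht
        rw [norm_inv, Real.norm_eq_abs]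
        exact inv_anti₀ ha (ht.trans (le_abs_self _))
      rw [tendsto_zero_iff_norm_tendsto_zero]
      have h0 := (tendsto_zero_iff_norm_tendsto_zero.1 hGD).const_mul a⁻¹
      rw [mul_zero] at h0
      refine squeeze_zero' (Eventually.of_forall fun _ => norm_nonneg _) ?_ h0
      filter_upwards [hb] with t ht
      rw [norm_smul]
      exact mul_le_mul_of_nonneg_right ht (norm_nonneg _)
    have := hstep₁.sub hsmall
    rw [sub_zero] at this
    refine this.congr' ?_
    filter_upwards [Ioo_mem_nhdsGT hc0] with t ht
    have hφp := hpos t (hc1 t ht)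
    have e1 : (-(t ^ (ζ - 1) * φ₁ t))⁻¹ = -((φ₁ t)⁻¹ * (t ^ (-ζ) * t)) := by
      rw [Real.rpow_sub ht.1, Real.rpow_one, Real.rpow_neg ht.1.le]
      have := Real.rpow_pos_of_pos ht.1 ζ
      have := ht.1
      field_simp
    have e2 : (t ^ (2 * ζ) * φ₁ t)⁻¹ * t ^ (ζ + 1) = (φ₁ t)⁻¹ * (t ^ (-ζ) * t) := by
      rw [two_mul, Real.rpow_add ht.1, Real.rpow_add ht.1, Real.rpow_one, Real.rpow_neg ht.1.le]
      have := Real.rpow_pos_of_pos ht.1 ζ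
      field_simp
    have ht' := ht.1.ne'
    rw [hψD, e1, smul_smul _ (t ^ (ζ + 1)), e2, mul_sub, mul_smul_comm, smul_sub, smul_smul,
      smul_smul, show -((φ₁ t)⁻¹ * (t ^ (-ζ) * t)) * t⁻¹ = -((φ₁ t)⁻¹ * t ^ (-ζ)) by field_simp]
    module

end SingularEquation

end Moebius

noncomputable section

namespace Moebius

variable {n : ℕ}

/-! ### Minkowski space -/

theorem rankOne_apply (v w x : Mink n) : rankOne v w x = mink n w x • v := rfl

theorem wedge_apply (v w x : Mink n) : wedge v w x = mink n v x • w - mink n w x • v := rfl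

/-- The Minkowski inner product as a continuous bilinear map. -/
def minkL (n : ℕ) : Mink n →L[ℝ] Mink n →L[ℝ] ℝ :=
  LinearMap.toContinuousLinearMap
    ((LinearMap.toContinuousLinearMap : (Mink n →ₗ[ℝ] ℝ) ≃ₗ[ℝ] (Mink n →L[ℝ] ℝ)).toLinearMap ∘ₗ mink n)

/-- `wedge v` as a continuous linear map. -/
def wedgeL (v : Mink n) : Mink n →L[ℝ] End n :=
  LinearMap.toContinuousLinearMap
    { toFun := wedge v
      map_add' := fun x y => by
        ext1 z
        simp only [wedge_apply, _root_.add_apply, map_add, LinearMap.add_apply]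
        module
      map_smul' := fun a x => by
        ext1 z
        simp only [wedge_apply, _root_.smul_apply, map_smul, LinearMap.smul_apply, RingHom.id_apply,
          smul_eq_mul]
        module }

theorem wedgeL_apply (v w : Mink n) : wedgeL v w = wedge v w := rfl

theorem wedge_swap (v w : Mink n) : wedge v w = -wedge w v := by
  simp [wedge]

theorem wedge_smul (a : ℝ) (v w : Mink n) : wedge v (a • w) = a • wedge v w := by
  simp only [← wedgeL_apply, map_smul]

theorem wedge_sub (v w x : Mink n) : wedge v (w - x) = wedge v w - wedge v x := by
  simp only [← wedgeL_apply, map_sub]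

theorem smul_wedge (a : ℝ) (v w : Mink n) : wedge (a • v) w = a • wedge v w := by
  rw [wedge_swap, wedge_smul, wedge_swap w v, smul_neg, neg_neg]

theorem sub_wedge (v w x : Mink n) : wedge (v - w) x = wedge v x - wedge w x := by
  rw [wedge_swap, wedge_sub, wedge_swap v, wedge_swap w]
  abel

theorem wedge_self (v : Mink n) : wedge v v = 0 := sub_self _

theorem HasDerivAt.mink {f g : ℝ → Mink n} {f' g' : Mink n} {t : ℝ} (hf : HasDerivAt f f' t)
    (hg : HasDerivAt g g' t) :
    HasDerivAt (fun u => mink n (f u) (g u)) (mink n (f t) g' + mink n f' (g t)) t := by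
  have h1 : HasDerivAt (fun u => minkL n (f u)) (minkL n f') t :=
    (minkL n).hasFDerivAt.comp_hasDerivAt t hf
  exact (h1.clm_apply hg).congr_deriv (add_comm _ _)

theorem continuous_mink : Continuous fun p : Mink n × Mink n => mink n p.1 p.2 :=
  (minkL n).continuous₂

/-- Vectors orthogonal to a null vector `c` and linearly independent of it are spacelike. -/
theorem mink_self_pos {c x : Mink n} (hc : mink n c c = 0) (hx : mink n c x = 0)
    (hli : LinearIndependent ℝ ![c, x]) : 0 < mink n x x := by
  have hc0 : c ≠ 0 := hli.ne_zero 0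
  have hsum : c 0 ^ 2 = ∑ i : Fin (n + 1), c i.succ ^ 2 := by
    rw [mink_apply] at hc
    have : ∑ i : Fin (n + 1), c i.succ ^ 2 = ∑ i : Fin (n + 1), c i.succ * c i.succ := by
      simp only [pow_two]
    rw [this]; linarith
  have hc00 : c 0 ≠ 0 := by
    intro h
    apply hc0
    rw [h, zero_pow two_ne_zero, eq_comm, Finset.sum_eq_zero_iff_of_nonneg (fun _ _ => sq_nonneg _)] at hsum
    funext j
    refine Fin.cases h (fun i => ?_) j
    exact pow_eq_zero_iff two_ne_zero |>.1 (hsum i (Finset.mem_univ i))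
  set a := x 0 / c 0 with ha
  have h0 : (x - a • c) 0 = 0 := by
    simp only [Pi.sub_apply, Pi.smul_apply, smul_eq_mul, ha]
    field_simp
    simp
  have hne : x - a • c ≠ 0 := by
    intro h
    have := (LinearIndependent.pair_iff.1 hli) (-a) 1 (by rw [one_smul, neg_smul, ← h]; abel)
    exact one_ne_zero this.2
  have he : mink n x x = mink n (x - a • c) (x - a • c) := by
    simp only [map_sub, map_smul, LinearMap.sub_apply, LinearMap.smul_apply, smul_eq_mul, hc, hx,
      mink_comm x c]
    ring
  rw [he, mink_apply, h0]
  simp only [mul_zero, neg_zero, zero_add]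
  refine lt_of_le_of_ne (Finset.sum_nonneg fun i _ => mul_self_nonneg _) fun h => hne ?_
  rw [eq_comm, Finset.sum_eq_zero_iff_of_nonneg (fun _ _ => mul_self_nonneg _)] at h
  funext j
  refine Fin.cases h0 (fun i => ?_) j
  exact mul_self_eq_zero.1 (h i (Finset.mem_univ i))

/-! ### Lorentz transformations -/

/-- A Lorentz transformation as a unit of the algebra of endomorphisms. -/
def Lorentz.toUnit (A : Lorentz n) : (End n)ˣ := ContinuousLinearEquiv.toUnit A.1

theorem Lorentz.val_inv_toUnit (A : Lorentz n) : ((A.toUnit⁻¹ : (End n)ˣ) : End n) = A⁻¹.toEnd := rfl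

theorem Lorentz.toEnd_mul (A B : Lorentz n) : (A * B).toEnd = A.toEnd * B.toEnd := rfl

theorem Lorentz.toEnd_one : (1 : Lorentz n).toEnd = 1 := rfl

theorem Lorentz.toEnd_mul_inv (A : Lorentz n) : A.toEnd * A⁻¹.toEnd = 1 := by
  rw [← toEnd_mul, mul_inv_cancel, toEnd_one]

theorem Lorentz.toEnd_inv_mul (A : Lorentz n) : A⁻¹.toEnd * A.toEnd = 1 := by
  rw [← toEnd_mul, inv_mul_cancel, toEnd_one]

theorem Lorentz.inv_apply (A : Lorentz n) (x : Mink n) : A⁻¹.toEnd (A.toEnd x) = x :=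
  DFunLike.congr_fun A.toEnd_inv_mul x

theorem Lorentz.apply_inv (A : Lorentz n) (x : Mink n) : A.toEnd (A⁻¹.toEnd x) = x :=
  DFunLike.congr_fun A.toEnd_mul_inv x

theorem Lorentz.mink_toEnd (A : Lorentz n) (x y : Mink n) :
    mink n (A.toEnd x) (A.toEnd y) = mink n x y := A.2 x y

theorem Lorentz.toEnd_ne_zero (A : Lorentz n) {x : Mink n} (hx : x ≠ 0) : A.toEnd x ≠ 0 := fun h =>
  hx (by rw [← A.inv_apply x, h, map_zero])

theorem Lorentz.toEnd_injective : Function.Injective (Lorentz.toEnd (n := n)) := fun _ _ h =>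
  Subtype.ext (ContinuousLinearEquiv.coe_injective h)

theorem Lorentz.mink_left (A : Lorentz n) (x y : Mink n) :
    mink n (A.toEnd x) y = mink n x (A⁻¹.toEnd y) := by
  rw [← A.mink_toEnd x, A.apply_inv]

theorem Lorentz.conj_wedge (A : Lorentz n) (v w : Mink n) :
    A⁻¹.toEnd * wedge v w * A.toEnd = wedge (A⁻¹.toEnd v) (A⁻¹.toEnd w) := by
  ext1 x
  change A⁻¹.toEnd (wedge v w (A.toEnd x)) = _
  rw [wedge_apply, wedge_apply, map_sub, map_smul, map_smul, Lorentz.mink_left, Lorentz.mink_left,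
    inv_inv]

theorem mink_skew_of_hasDerivAt {F : ℝ → Lorentz n} {A : End n} {t : ℝ}
    (hF : HasDerivAt (fun τ => (F τ).toEnd) ((F t).toEnd * A) t) (x y : Mink n) :
    mink n (A x) y = -mink n x (A y) := by
  have h1 : ∀ z : Mink n, HasDerivAt (fun τ => (F τ).toEnd z) ((F t).toEnd (A z)) t := fun z =>
    (hF.clm_apply (hasDerivAt_const t z)).congr_deriv (by simp)
  have h2 := HasDerivAt.mink (h1 x) (h1 y)
  simp only [Lorentz.mink_toEnd] at h2
  have := h2.unique (hasDerivAt_const t _)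
  linarith

theorem Lorentz.hasDerivAt_inv {F : ℝ → Lorentz n} {F' : End n} {t : ℝ}
    (hF : HasDerivAt (fun τ => (F τ).toEnd) F' t) :
    HasDerivAt (fun τ => (F τ)⁻¹.toEnd) (-((F t)⁻¹.toEnd * F' * (F t)⁻¹.toEnd)) t := by
  have h := (hasFDerivAt_ringInverse (𝕜 := ℝ) (F t).toUnit).comp_hasDerivAt t hF
  have he : (fun τ => (F τ)⁻¹.toEnd) = Ring.inverse ∘ fun τ => (F τ).toEnd := by
    funext τ
    exact (Ring.inverse_unit (F τ).toUnit).symm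
  rw [he]
  exact h.congr_deriv (by simp [Lorentz.val_inv_toUnit])

/-- Two solutions of `Γ' = Γ ψ` differ by a constant factor. -/
theorem mul_inv_eq_of_hasDerivAt {ψ : ℝ → End n} {b : ℝ} {G H : ℝ → Lorentz n}
    (hG : ∀ t ∈ Ioo 0 b, HasDerivAt (fun τ => (G τ).toEnd) ((G t).toEnd * ψ t) t)
    (hH : ∀ t ∈ Ioo 0 b, HasDerivAt (fun τ => (H τ).toEnd) ((H t).toEnd * ψ t) t)
    {p t : ℝ} (hp : p ∈ Ioo 0 b) (ht : t ∈ Ioo 0 b) : G t * (H t)⁻¹ = G p * (H p)⁻¹ := by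
  apply Lorentz.toEnd_injective
  rw [Lorentz.toEnd_mul, Lorentz.toEnd_mul]
  have hd : ∀ u ∈ Ioo 0 b, HasDerivAt (fun τ => (G τ).toEnd * (H τ)⁻¹.toEnd) 0 u := by
    intro u hu
    refine ((hG u hu).mul (Lorentz.hasDerivAt_inv (hH u hu))).congr_deriv ?_
    have : (H u)⁻¹.toEnd * ((H u).toEnd * ψ u) * (H u)⁻¹.toEnd = ψ u * (H u)⁻¹.toEnd := by
      rw [← mul_assoc, Lorentz.toEnd_inv_mul, one_mul]
    rw [this, mul_assoc]
    exact (congrArg _ (mul_neg (G u).toEnd (ψ u * (H u)⁻¹.toEnd))).trans (add_neg_cancel _)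
  exact isOpen_Ioo.is_const_of_deriv_eq_zero isPreconnected_Ioo
    (fun u hu => (hd u hu).differentiableAt.differentiableWithinAt) (fun u hu => (hd u hu).deriv) ht hp

/-- A linear isometry of Minkowski space as a Lorentz transformation. -/
def Lorentz.ofIsometry (T : Mink n →ₗ[ℝ] Mink n) (hT : ∀ x y, mink n (T x) (T y) = mink n x y) :
    Lorentz n :=
  ⟨(LinearEquiv.ofInjectiveEndo T (by
      rw [← LinearMap.ker_eq_bot, LinearMap.ker_eq_bot']
      intro x hx
      by_contra h
      obtain ⟨y, hy⟩ := mink_nondegenerate h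
      rw [← hT, hx] at hy
      simp at hy)).toContinuousLinearEquiv, mem_lorentzGroup.2 hT⟩

/-! ### The sphere -/

theorem LightCone.span_eq_iff {v w : LightCone n} :
    v.span = w.span ↔ ∃ a : ℝ, a ≠ 0 ∧ (v : Mink n) = a • (w : Mink n) := by
  rw [LightCone.span, LightCone.span, Subtype.mk.injEq, Projectivization.mk_eq_mk_iff']
  constructor
  · rintro ⟨a, ha⟩
    refine ⟨a, fun h => v.2.1 ?_, ha.symm⟩
    rw [← ha, h, zero_smul]
  · rintro ⟨a, _, ha⟩
    exact ⟨a, ha.symm⟩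

/-- The action of a Lorentz transformation on the light cone. -/
def Lorentz.actCone (A : Lorentz n) (v : LightCone n) : LightCone n :=
  ⟨A.toEnd v, A.toEnd_ne_zero v.2.1, by rw [A.mink_toEnd]; exact v.2.2⟩

theorem Lorentz.coe_actCone (A : Lorentz n) (v : LightCone n) :
    (A.actCone v : Mink n) = A.toEnd v := rfl

theorem Lorentz.act_span (A : Lorentz n) (v : LightCone n) : A.act v.span = (A.actCone v).span := rfl

theorem tendsto_mk {V : Type*} [AddCommGroup V] [Module ℝ V] [TopologicalSpace V]
    {α : Type*} {l : Filter α} {f : α → V} {φ : α → ℝ} {v : V} (hv : v ≠ 0) (hf0 : ∀ a, f a ≠ 0)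
    (hφ : ∀ᶠ a in l, φ a ≠ 0) (hf : Tendsto (fun a => φ a • f a) l (𝓝 v)) :
    Tendsto (fun a => Projectivization.mk ℝ (f a) (hf0 a)) l (𝓝 (Projectivization.mk ℝ v hv)) := by
  classical
  obtain ⟨χ, hχ0, hχ⟩ : ∃ χ : α → ℝ, (∀ a, χ a ≠ 0) ∧ ∀ a, φ a ≠ 0 → χ a = φ a := by
    refine ⟨fun a => if φ a = 0 then 1 else φ a, fun a => ?_, fun a ha => if_neg ha⟩
    dsimp only
    split_ifs with h
    · exact one_ne_zero
    · exact h
  have hc : Continuous (Projectivization.mk' ℝ : {v : V // v ≠ 0} → ℙ ℝ V) := continuous_coinduced_rng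
  have h : Tendsto (fun a => (⟨χ a • f a, smul_ne_zero (hχ0 a) (hf0 a)⟩ : {v : V // v ≠ 0})) l
      (𝓝 ⟨v, hv⟩) := by
    refine tendsto_subtype_rng.2 (hf.congr' ?_)
    filter_upwards [hφ] with a ha
    rw [hχ a ha]
  refine ((hc.tendsto _).comp h).congr fun a => ?_
  exact (Projectivization.mk_eq_mk_iff' ℝ _ _ _ _).2 ⟨χ a, rfl⟩

theorem LightCone.tendsto_span {α : Type*} {l : Filter α} {v : α → LightCone n} {φ : α → ℝ}
    {k : LightCone n} (hφ : ∀ᶠ a in l, φ a ≠ 0)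
    (h : Tendsto (fun a => φ a • (v a : Mink n)) l (𝓝 k)) :
    Tendsto (fun a => (v a).span) l (𝓝 k.span) :=
  tendsto_subtype_rng.2 (tendsto_mk k.2.1 (fun a => (v a).2.1) hφ h)

namespace PseudoTriple

variable (B : PseudoTriple n)

theorem τ_o : mink n B.τ B.o = 0 := (mink_comm _ _).trans B.o_τ
theorem τ_ι : mink n B.τ B.ι = 0 := (mink_comm _ _).trans B.ι_τ

theorem coe_vPlus (μ : ℝ) : (B.vPlus μ : Mink n) =
    ((1 + √(1 - 2 * μ)) ^ 2 / 2) • B.o + B.ι - (1 + √(1 - 2 * μ)) • B.τ := rfl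

theorem coe_vMinus (μ : ℝ) : (B.vMinus μ : Mink n) =
    ((1 - √(1 - 2 * μ)) ^ 2 / 2) • B.o + B.ι - (1 - √(1 - 2 * μ)) • B.τ := rfl

theorem mink_vMinus_o (μ : ℝ) : mink n (B.vMinus μ) B.o = -1 := by
  simp [coe_vMinus, B.o_o, B.ι_o, B.τ_o]

/-- The residue of the singular connection form. -/
def residue (μ : ℝ) : End n := wedge (B.o - B.τ) (B.ι - μ • B.τ)

theorem residue_sq_add {μ : ℝ} (hμ : 0 ≤ 1 - 2 * μ) :
    B.residue μ * B.residue μ + √(1 - 2 * μ) • B.residue μ =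
      -rankOne (B.vPlus μ : Mink n) (B.vMinus μ) := by
  obtain ⟨ζ, hζ⟩ : ∃ ζ, √(1 - 2 * μ) = ζ := ⟨_, rfl⟩
  have hμζ : μ = (1 - ζ ^ 2) / 2 := by rw [← hζ, Real.sq_sqrt hμ]; ring
  ext1 x
  change B.residue μ (B.residue μ x) + √(1 - 2 * μ) • B.residue μ x = -(rankOne _ _ x)
  rw [coe_vPlus, coe_vMinus, hζ, hμζ]
  simp only [residue, wedge_apply, rankOne_apply, map_sub, map_add, map_smul, LinearMap.sub_apply,
    LinearMap.add_apply, LinearMap.smul_apply, smul_eq_mul, B.o_o, B.ι_ι, B.o_ι, B.ι_o, B.o_τ,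
    B.ι_τ, B.τ_τ, B.τ_o, B.τ_ι]
  module

theorem residue_mul {μ : ℝ} (hμ : 0 ≤ 1 - 2 * μ) :
    B.residue μ * (B.residue μ * B.residue μ + √(1 - 2 * μ) • B.residue μ) =
      √(1 - 2 * μ) • (B.residue μ * B.residue μ + √(1 - 2 * μ) • B.residue μ) := by
  rw [B.residue_sq_add hμ]
  ext1 x
  change B.residue μ (-(mink n (B.vMinus μ) x • (B.vPlus μ : Mink n))) =
    √(1 - 2 * μ) • -(mink n (B.vMinus μ) x • (B.vPlus μ : Mink n))
  rw [map_neg, map_smul, residue, B.wedge_vPlus hμ]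
  module

/-- The boost as an affine combination of endomorphisms. -/
theorem toEnd_boost {r : ℝ} (hr : r ≠ 0) : (B.boost r).toEnd =
    1 - (r⁻¹ - 1) • rankOne B.o B.ι - (r - 1) • rankOne B.ι B.o := by
  ext1 x
  rw [B.boost_apply hr, boostFun_apply]
  change _ = x - (r⁻¹ - 1) • (mink n B.ι x • B.o) - (r - 1) • (mink n B.o x • B.ι)
  module

theorem boost_inv {r : ℝ} (hr : r ≠ 0) : (B.boost r)⁻¹ = B.boost r⁻¹ := by
  rw [inv_eq_iff_mul_eq_one]
  apply Lorentz.toEnd_injective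
  ext1 x
  change (B.boost r).toEnd ((B.boost r⁻¹).toEnd x) = x
  rw [B.boost_apply hr, B.boost_apply (inv_ne_zero hr)]
  simpa using B.boostFun_inv r⁻¹ (inv_ne_zero hr) x

theorem hasDerivAt_boost {r : ℝ → ℝ} {r' t : ℝ} (hr : HasDerivAt r r' t) (h0 : r t ≠ 0) :
    HasDerivAt (fun u => (B.boost (r u)).toEnd)
      ((B.boost (r t)).toEnd * (-(r' / r t) • wedge B.o B.ι)) t := by
  have h1 : HasDerivAt (fun u => 1 - ((r u)⁻¹ - 1) • rankOne B.o B.ι - (r u - 1) • rankOne B.ι B.o)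
      (-(-r' / r t ^ 2) • rankOne B.o B.ι - r' • rankOne B.ι B.o) t :=
    (((((hr.inv h0).sub_const 1).smul_const (rankOne B.o B.ι)).const_sub 1).sub
      ((hr.sub_const 1).smul_const (rankOne B.ι B.o))).congr_deriv (by module)
  refine (h1.congr_of_eventuallyEq ?_).congr_deriv ?_
  · filter_upwards [hr.continuousAt.eventually_ne h0] with u hu
    exact B.toEnd_boost hu
  · ext1 x
    change -(-r' / r t ^ 2) • (mink n B.ι x • B.o) - r' • (mink n B.o x • B.ι) =
      (B.boost (r t)).toEnd (-(r' / r t) • (wedge B.o B.ι x))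
    rw [wedge_apply, map_smul, map_sub, map_smul, map_smul, B.boost_o h0, B.boost_ι h0, smul_sub,
      smul_smul, smul_smul, smul_smul, smul_smul, smul_smul, smul_smul]
    have e1 : -(r' / r t) * mink n B.o x * r t = -(r' * mink n B.o x) := by field_simp
    have e2 : -(r' / r t) * mink n B.ι x * (r t)⁻¹ = -r' / r t ^ 2 * mink n B.ι x := by
      field_simp
    rw [e1, e2]
    module

end PseudoTriple

end Moebius

end

namespace Moebius

variable {n : ℕ}

theorem hasDerivAt_mul_apply {F : ℝ → Lorentz n} {A : End n} {t : ℝ}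
    (hF : HasDerivAt (fun τ => (F τ).toEnd) ((F t).toEnd * A) t) (x : Mink n) :
    HasDerivAt (fun τ => (F τ).toEnd x) ((F t).toEnd (A x)) t :=
  (hF.clm_apply (hasDerivAt_const t x)).congr_deriv (by simp)

/-- The associated 1-form in terms of an arbitrary frame whose first vector is a lift. -/
theorem assocForm_eq_of_lift (B : PseudoTriple n) {c : ℝ → LightCone n} {F : ℝ → Lorentz n}
    {A : End n} {t : ℝ} (Q : ℝ → ℝ)
    (hF : HasDerivAt (fun τ => (F τ).toEnd) ((F t).toEnd * A) t)
    (hlift : ∀ᶠ u in 𝓝 t, (F u).act B.oL.span = (c u).span)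
    (hc : DifferentiableAt ℝ (fun u => (c u : Mink n)) t) :
    assocForm c Q t =
      (Q t / mink n (A B.o) (A B.o)) • wedge ((F t).toEnd B.o) ((F t).toEnd (A B.o)) := by
  obtain ⟨e, he⟩ := mink_nondegenerate (c t).2.1
  have hc' := hc.hasDerivAt
  set c' := deriv (fun u => (c u : Mink n)) t with hc'def
  have hf := hasDerivAt_mul_apply hF B.o
  set κ : ℝ → ℝ := fun u => mink n ((F u).toEnd B.o) e / mink n (c u : Mink n) e with hκ
  have hce := HasDerivAt.mink hc' (hasDerivAt_const t e)
  have hfe := HasDerivAt.mink hf (hasDerivAt_const t e)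
  have hκ' := hfe.div hce he
  have hfκ : ∀ᶠ u in 𝓝 t, (F u).toEnd B.o = κ u • (c u : Mink n) := by
    filter_upwards [hlift, hce.continuousAt.eventually_ne he] with u hu hne
    rw [Lorentz.act_span, LightCone.span_eq_iff] at hu
    obtain ⟨a, -, ha⟩ := hu
    rw [Lorentz.coe_actCone] at ha
    change (F u).toEnd B.o = _ at ha
    rw [hκ]
    simp only [ha, map_smul, LinearMap.smul_apply, smul_eq_mul]
    rw [mul_div_assoc, div_self hne, mul_one]
  have hκ0 : κ t ≠ 0 := by
    intro h
    have := hfκ.self_of_nhds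
    rw [h, zero_smul] at this
    exact (F t).toEnd_ne_zero B.oL.2.1 this
  have hder := hf.unique ((hκ'.smul hc').congr_of_eventuallyEq hfκ)
  obtain ⟨k', hk'⟩ : ∃ k' : ℝ, (F t).toEnd (A B.o) = κ t • c' + k' • (c t : Mink n) := ⟨_, hder⟩
  have hcc : mink n (c t : Mink n) c' = 0 := by
    have h1 := HasDerivAt.mink hc' hc'
    have h2 : (fun u => mink n (c u : Mink n) (c u)) = fun _ => 0 := funext fun u => (c u).2.2
    rw [h2] at h1
    have := h1.unique (hasDerivAt_const t 0)
    rw [mink_comm c'] at this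
    linarith
  have hnorm : mink n (A B.o) (A B.o) = κ t ^ 2 * mink n c' c' := by
    rw [← (F t).mink_toEnd, hk']
    simp only [map_add, map_smul, LinearMap.add_apply, LinearMap.smul_apply, smul_eq_mul, hcc,
      mink_comm c' (c t), (c t).2.2]
    ring
  have hw : wedge ((F t).toEnd B.o) ((F t).toEnd (A B.o)) = κ t ^ 2 • wedge (c t : Mink n) c' := by
    rw [hk', hfκ.self_of_nhds]
    ext1 x
    change _ = κ t ^ 2 • wedge (c t : Mink n) c' x
    simp only [wedge_apply, map_add, map_smul, LinearMap.add_apply, LinearMap.smul_apply, smul_eq_mul]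
    module
  rw [hw, hnorm, smul_smul]
  change (Q t / mink n c' c') • wedge (c t : Mink n) c' = _
  congr 1
  rw [div_mul_eq_mul_div, mul_comm (Q t), mul_div_mul_left _ _ (pow_ne_zero 2 hκ0)]

theorem hasDerivAt_singularGauge (B : PseudoTriple n) {F : ℝ → Lorentz n} {A : End n} {t r' : ℝ}
    {r : ℝ → ℝ} (hF : HasDerivAt (fun τ => (F τ).toEnd) ((F t).toEnd * A) t)
    (hr : HasDerivAt r r' t) (hr0 : r t ≠ 0) :
    HasDerivAt (fun τ => (singularGauge B r F τ).toEnd) ((singularGauge B r F t).toEnd *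
      ((B.boost (r t))⁻¹.toEnd * A * (B.boost (r t)).toEnd + -(r' / r t) • wedge B.o B.ι)) t := by
  refine (hF.mul (B.hasDerivAt_boost hr hr0)).congr_deriv ?_
  have : (singularGauge B r F t).toEnd * ((B.boost (r t))⁻¹.toEnd * A * (B.boost (r t)).toEnd) =
      (F t).toEnd * A * (B.boost (r t)).toEnd := by
    rw [singularGauge, Lorentz.toEnd_mul, mul_assoc, ← mul_assoc _ _ (B.boost (r t)).toEnd,
      ← mul_assoc (B.boost (r t)).toEnd, Lorentz.toEnd_mul_inv, one_mul, ← mul_assoc]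
  rw [mul_add, this, singularGauge, Lorentz.toEnd_mul, mul_assoc _ _ (-(r' / r t) • _)]

theorem boost_conj (B : PseudoTriple n) {A : End n} {r : ℝ} (hr0 : r ≠ 0)
    (hA : ∀ x y, mink n (A x) y = -mink n x (A y)) (hι : mink n B.ι (A B.o) = 0) :
    (B.boost r)⁻¹.toEnd * A * (B.boost r).toEnd = wedge (r⁻¹ • A B.o) B.ι +
      (1 - (r - 1) • rankOne B.o B.ι) * (A - wedge (A B.o) B.ι) *
        (1 - (r - 1) • rankOne B.ι B.o) := by
  have hoo : mink n B.o (A B.o) = 0 := by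
    have := hA B.o B.o
    rw [mink_comm (A B.o)] at this
    linarith
  have hιι : mink n B.ι (A B.ι) = 0 := by
    have := hA B.ι B.ι
    rw [mink_comm (A B.ι)] at this
    linarith
  have hoι : mink n B.o (A B.ι) = 0 := by
    rw [mink_comm, hA, hι, neg_zero]
  ext1 x
  have hox : mink n B.o (A x) = -mink n (A B.o) x := by rw [hA, neg_neg]
  rw [B.boost_inv hr0]
  change (B.boost r⁻¹).toEnd (A ((B.boost r).toEnd x)) =
    (wedge (r⁻¹ • A B.o) B.ι) x + (fun y => y - (r - 1) • rankOne B.o B.ι y)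
      ((fun y => A y - wedge (A B.o) B.ι y) (x - (r - 1) • rankOne B.ι B.o x))
  rw [B.boost_apply (inv_ne_zero hr0), B.boost_apply hr0]
  simp only [PseudoTriple.boostFun_apply, wedge_apply, rankOne_apply, map_sub, map_smul,
    LinearMap.smul_apply, smul_eq_mul, hoo, hιι, hoι, hox, hι, B.ι_ι, mink_comm (A B.o) B.ι, inv_inv]
  match_scalars <;> field_simp <;> ring

/-- The gauge transform of `λ ω` by a singular gauge transformation. -/
theorem gauge_singularGauge_eq (B : PseudoTriple n) {c : ℝ → LightCone n} {F : ℝ → Lorentz n}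
    {A : End n} {t r' lam : ℝ} {r : ℝ → ℝ} (Q : ℝ → ℝ)
    (hF : HasDerivAt (fun τ => (F τ).toEnd) ((F t).toEnd * A) t)
    (hlift : ∀ᶠ u in 𝓝 t, (F u).act B.oL.span = (c u).span)
    (hc : DifferentiableAt ℝ (fun u => (c u : Mink n)) t)
    (hr : HasDerivAt r r' t) (hr0 : r t ≠ 0) (hι : mink n B.ι (A B.o) = 0) {ξ : Mink n}
    (hξ : ξ = (r t)⁻¹ • A B.o) :
    gauge (singularGauge B r F) (fun t => lam • assocForm c Q t) t =
      (lam * (Q t / mink n ξ ξ)) • wedge B.o ξ + wedge ξ B.ι - (r' / r t) • wedge B.o B.ι +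
      (1 - (r t - 1) • rankOne B.o B.ι) * (A - wedge (A B.o) B.ι) *
        (1 - (r t - 1) • rankOne B.ι B.o) := by
  have hA := mink_skew_of_hasDerivAt hF
  have hoo : mink n B.o (A B.o) = 0 := by
    have := hA B.o B.o
    rw [mink_comm (A B.o)] at this
    linarith
  have hd := (hasDerivAt_singularGauge B hF hr hr0).deriv
  have hω : (singularGauge B r F t)⁻¹.toEnd * (lam • assocForm c Q t) *
      (singularGauge B r F t).toEnd = (lam * (Q t / mink n ξ ξ)) • wedge B.o ξ := by
    have hAξ : A B.o = r t • ξ := by rw [hξ, smul_smul, mul_inv_cancel₀ hr0, one_smul]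
    have hwedge : (singularGauge B r F t)⁻¹.toEnd *
        wedge ((F t).toEnd B.o) ((F t).toEnd (A B.o)) * (singularGauge B r F t).toEnd =
        r t ^ 2 • wedge B.o ξ := by
      rw [Lorentz.conj_wedge, singularGauge, mul_inv_rev, Lorentz.toEnd_mul]
      change wedge ((B.boost (r t))⁻¹.toEnd ((F t)⁻¹.toEnd ((F t).toEnd B.o)))
        ((B.boost (r t))⁻¹.toEnd ((F t)⁻¹.toEnd ((F t).toEnd (A B.o)))) = _
      rw [Lorentz.inv_apply, Lorentz.inv_apply, B.boost_inv hr0, B.boost_o (inv_ne_zero hr0),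
        B.boost_perp (inv_ne_zero hr0) hoo hι, hAξ, inv_inv, smul_wedge, wedge_smul, smul_smul, pow_two]
    rw [assocForm_eq_of_lift B Q hF hlift hc, smul_smul, mul_smul_comm, smul_mul_assoc, hwedge,
      smul_smul, hAξ]
    congr 1
    simp only [map_smul, LinearMap.smul_apply, smul_eq_mul]
    rw [← mul_assoc (r t) (r t), mul_assoc, div_mul_eq_mul_div, mul_comm (Q t), ← pow_two,
      mul_div_mul_left _ _ (pow_ne_zero 2 hr0)]
  have hg : gauge (singularGauge B r F) (fun t => lam • assocForm c Q t) t =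
      (singularGauge B r F t)⁻¹.toEnd * (lam • assocForm c Q t) * (singularGauge B r F t).toEnd +
        (singularGauge B r F t)⁻¹.toEnd * deriv (fun τ => (singularGauge B r F τ).toEnd) t := rfl
  rw [hg, hω, hd, ← mul_assoc, Lorentz.toEnd_inv_mul, one_mul, boost_conj B hr0 hA hι, ← hξ]
  module

theorem isBigO_mul_sub {E : Type*} [NormedAddCommGroup E] [NormedSpace ℝ E] {l : Filter ℝ}
    {f : ℝ → ℝ} {g : ℝ → E} {f₀ : ℝ} {g₀ : E} (hl : Tendsto (fun t => t) l (𝓝 0))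
    (hf : (fun t => f t - f₀) =O[l] (fun t => t)) (hg : (fun t => g t - g₀) =O[l] (fun t => t)) :
    (fun t => f t • g t - f₀ • g₀) =O[l] (fun t => t) := by
  have ht : (fun t : ℝ => t) =O[l] (fun _ => (1 : ℝ)) := hl.isBigO_one ℝ
  have hg1 : g =O[l] (fun _ => (1 : ℝ)) := by
    simpa using (hg.trans ht).add (Asymptotics.isBigO_const_const g₀ (one_ne_zero (α := ℝ)) l)
  have h1 : (fun t => (f t - f₀) • g t) =O[l] (fun t => t) := by
    simpa using hf.smul hg1
  refine (h1.add (hg.const_smul_left f₀)).congr_left fun t => ?_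
  simp only [Pi.smul_apply]
  module

/-- The gauge transform of `λ ω` by a singular gauge transformation has a simple pole. -/
theorem gauge_singularGauge_isBigO (B : PseudoTriple n) {c : ℝ → LightCone n} {F : ℝ → Lorentz n}
    {A : ℝ → End n} {q lam a : ℝ} {r r' Q : ℝ → ℝ} (ha : 0 < a)
    (hF : ∀ t ∈ Ioo 0 a, HasDerivAt (fun τ => (F τ).toEnd) ((F t).toEnd * A t) t)
    (hA : A =O[𝓝[>] 0] (fun _ => (1 : ℝ)))
    (hlift : ∀ t ∈ Ioo 0 a, (F t).act B.oL.span = (c t).span)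
    (hc : ∀ t ∈ Ioo 0 a, DifferentiableAt ℝ (fun u => (c u : Mink n)) t)
    (hr : ∀ t ∈ Ioo 0 a, HasDerivAt r (r' t) t) (hr0 : ∀ t ∈ Ioo 0 a, r t ≠ 0)
    (hr1 : r =O[𝓝[>] 0] (fun _ => (1 : ℝ)))
    (hr2 : (fun t => r' t / r t - t⁻¹) =O[𝓝[>] 0] (fun _ => (1 : ℝ)))
    (hι : ∀ t ∈ Ioo 0 a, mink n B.ι (A t B.o) = 0)
    (hξ : (fun t => (r t)⁻¹ • A t B.o - t⁻¹ • B.τ) =O[𝓝[>] 0] (fun _ => (1 : ℝ)))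
    (hQ : (fun t => Q t * t ^ 2 - q) =O[𝓝[>] 0] (fun t => t)) :
    (fun t => gauge (singularGauge B r F) (fun t => lam • assocForm c Q t) t +
      t⁻¹ • B.residue (lam * q)) =O[𝓝[>] 0] (fun _ => (1 : ℝ)) := by
  have hid : Tendsto (fun t : ℝ => t) (𝓝[>] 0) (𝓝 0) := tendsto_id.mono_left nhdsWithin_le_nhds
  have hpos : ∀ᶠ t in 𝓝[>] (0 : ℝ), 0 < t := self_mem_nhdsWithin
  obtain ⟨ξ, hξdef⟩ : ∃ ξ : ℝ → Mink n, ∀ t, ξ t = (r t)⁻¹ • A t B.o := ⟨_, fun _ => rfl⟩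
  simp only [← hξdef] at hξ
  obtain ⟨η, hηdef⟩ : ∃ η : ℝ → Mink n, ∀ t, η t = t • ξ t := ⟨_, fun _ => rfl⟩
  have hη : (fun t => η t - B.τ) =O[𝓝[>] 0] (fun t => t) := by
    refine ((Asymptotics.isBigO_refl (fun t : ℝ => t) (𝓝[>] 0)).smul hξ).congr' ?_
      (Eventually.of_forall fun t => by simp)
    filter_upwards [hpos] with t ht
    rw [hηdef, smul_sub, smul_smul, mul_inv_cancel₀ ht.ne', one_smul]
  have hηlim : Tendsto η (𝓝[>] 0) (𝓝 B.τ) := by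
    have := (hη.trans_tendsto hid).add_const B.τ
    simpa using this
  have hnlim : Tendsto (fun t => mink n (η t) (η t)) (𝓝[>] 0) (𝓝 1) := by
    have := (continuous_mink.tendsto (B.τ, B.τ)).comp (hηlim.prodMk_nhds hηlim)
    rwa [B.τ_τ] at this
  have hn : (fun t => mink n (η t) (η t) - 1) =O[𝓝[>] 0] (fun t => t) := by
    have hη1 : η =O[𝓝[>] 0] (fun _ => (1 : ℝ)) := hηlim.isBigO_one ℝ
    have h1 : (fun t => minkL n (η t - B.τ) (η t)) =O[𝓝[>] 0] (fun t => t) := by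
      refine ((minkL n).isBoundedBilinearMap.isBigO_comp).trans ?_
      simpa using hη.norm_left.mul hη1.norm_left
    have h2 : (fun t => minkL n B.τ (η t - B.τ)) =O[𝓝[>] 0] (fun t => t) :=
      ((minkL n B.τ).isBigO_comp _ _).trans hη
    refine (h1.add h2).congr_left fun t => ?_
    have e1 : minkL n (η t - B.τ) (η t) = mink n (η t - B.τ) (η t) := rfl
    have e2 : minkL n B.τ (η t - B.τ) = mink n B.τ (η t - B.τ) := rfl
    rw [e1, e2, map_sub, map_sub, LinearMap.sub_apply, B.τ_τ]
    ring
  have hninv : (fun t => (mink n (η t) (η t))⁻¹ - 1) =O[𝓝[>] 0] (fun t => t) := by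
    have h1 : (fun t => (mink n (η t) (η t))⁻¹) =O[𝓝[>] 0] (fun _ => (1 : ℝ)) :=
      (hnlim.inv₀ one_ne_zero).isBigO_one ℝ
    have h2 : (fun t => (mink n (η t) (η t))⁻¹ * (mink n (η t) (η t) - 1)) =O[𝓝[>] 0]
        (fun t => t) := by simpa using h1.mul hn
    refine h2.neg_left.congr' ?_ (EventuallyEq.refl _ _)
    filter_upwards [hnlim.eventually_ne one_ne_zero] with t ht
    rw [mul_sub, inv_mul_cancel₀ ht]
    ring
  have hT : (fun t => (Q t * t ^ 2) • ((mink n (η t) (η t))⁻¹ • wedge B.o (η t)) -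
      q • ((1 : ℝ) • wedge B.o B.τ)) =O[𝓝[>] 0] (fun t => t) := by
    refine isBigO_mul_sub hid hQ (isBigO_mul_sub hid hninv ?_)
    refine (((wedgeL B.o).isBigO_comp _ _).trans hη).congr_left fun t => ?_
    rw [map_sub]
    rfl
  have hinv : (fun t : ℝ => t⁻¹ * t) =O[𝓝[>] 0] (fun _ => (1 : ℝ)) := by
    refine (Asymptotics.isBigO_refl (fun _ => (1 : ℝ)) _).congr' ?_ (EventuallyEq.refl _ _)
    filter_upwards [hpos] with t ht
    rw [inv_mul_cancel₀ ht.ne']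
  have h1 : (fun t => lam • (t⁻¹ • ((Q t * t ^ 2) • ((mink n (η t) (η t))⁻¹ • wedge B.o (η t)) -
      q • ((1 : ℝ) • wedge B.o B.τ)))) =O[𝓝[>] 0] (fun _ => (1 : ℝ)) :=
    (((Asymptotics.isBigO_refl (fun t : ℝ => t⁻¹) (𝓝[>] 0)).smul hT).trans hinv).const_smul_left lam
  have h2 : (fun t => wedgeL B.ι (ξ t - t⁻¹ • B.τ)) =O[𝓝[>] 0] (fun _ => (1 : ℝ)) :=
    ((wedgeL B.ι).isBigO_comp _ _).trans hξ
  have h3 : (fun t => (r' t / r t - t⁻¹) • wedge B.o B.ι) =O[𝓝[>] 0] (fun _ => (1 : ℝ)) := by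
    simpa using hr2.smul
      (Asymptotics.isBigO_const_const (wedge B.o B.ι) (one_ne_zero (α := ℝ)) (𝓝[>] 0))
  have h4 : (fun t => (1 - (r t - 1) • rankOne B.o B.ι) * (A t - wedge (A t B.o) B.ι) *
        (1 - (r t - 1) • rankOne B.ι B.o)) =O[𝓝[>] 0] (fun _ => (1 : ℝ)) := by
    have hc1 : ∀ M : End n, (fun _ : ℝ => M) =O[𝓝[>] 0] (fun _ => (1 : ℝ)) := fun M =>
      Asymptotics.isBigO_const_const M one_ne_zero _
    have hrr : (fun t => r t - 1) =O[𝓝[>] 0] (fun _ => (1 : ℝ)) :=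
      hr1.sub (Asymptotics.isBigO_refl _ _)
    have hP : ∀ M : End n, (fun t => 1 - (r t - 1) • M) =O[𝓝[>] 0] (fun _ => (1 : ℝ)) := fun M =>
      (hc1 1).sub (by simpa using hrr.smul (hc1 M))
    have hAo : (fun t => A t B.o) =O[𝓝[>] 0] (fun _ => (1 : ℝ)) :=
      ((ContinuousLinearMap.apply ℝ (Mink n) B.o).isBigO_comp A _).trans hA
    have hw : (fun t => wedge (A t B.o) B.ι) =O[𝓝[>] 0] (fun _ => (1 : ℝ)) := by
      refine (((wedgeL B.ι).isBigO_comp _ _).trans hAo).neg_left.congr_left fun t => ?_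
      rw [wedge_swap]
      rfl
    simpa using ((hP _).mul (hA.sub hw)).mul (hP _)
  refine (((h1.sub h2).sub h3).add h4).congr' ?_ (EventuallyEq.refl _ _)
  filter_upwards [Ioo_mem_nhdsGT ha] with t ht
  have hlt : ∀ᶠ u in 𝓝 t, (F u).act B.oL.span = (c u).span :=
    Filter.mem_of_superset (Ioo_mem_nhds ht.1 ht.2) hlift
  rw [gauge_singularGauge_eq B Q (hF t ht) hlt (hc t ht) (hr t ht) (hr0 t ht) (hι t ht)
    (hξdef t)]
  have e1 : t⁻¹ • ((Q t * t ^ 2) • ((mink n (η t) (η t))⁻¹ • wedge B.o (η t))) =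
      (Q t / mink n (ξ t) (ξ t)) • wedge B.o (ξ t) := by
    have ht0 := ht.1.ne'
    simp only [hηdef, map_smul, LinearMap.smul_apply, smul_eq_mul, wedge_smul, smul_smul]
    congr 1
    field_simp
  have e2 : wedge (ξ t) B.ι = -wedge B.ι (ξ t) := wedge_swap _ _
  rw [smul_sub t⁻¹, e1, e2, map_sub, map_smul, wedgeL_apply, wedgeL_apply, PseudoTriple.residue,
    sub_wedge, wedge_sub, wedge_sub, wedge_smul, wedge_smul, wedge_self, wedge_swap B.τ B.ι]
  module

end Moebius

noncomputable section

namespace Moebius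

variable {n : ℕ}

/-- Asymptotics of a primitive of a form with a simple pole and residue `-(o - τ) ∧ (ι - μ τ)`. -/
theorem exists_primitive_asymptotics (B : PseudoTriple n) {μ : ℝ} (hμ : 0 ≤ 1 - 2 * μ)
    {ψ : ℝ → End n} (hψ : (fun t => ψ t + t⁻¹ • B.residue μ) =O[𝓝[>] 0] (fun _ => (1 : ℝ)))
    {b : ℝ} (hb : 0 < b) {G : ℝ → Lorentz n}
    (hG : ∀ t ∈ Ioo 0 b, HasDerivAt (fun τ => (G τ).toEnd) ((G t).toEnd * ψ t) t) :
    ∃ k : LightCone n,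
      Tendsto (fun t => t ^ (-√(1 - 2 * μ)) • (G t)⁻¹.toEnd k) (𝓝[>] 0) (𝓝 (B.vPlus μ : Mink n)) ∧
      ∃ φ : ℝ → ℝ, (∀ᶠ t in 𝓝[>] 0, φ t ≠ 0) ∧
        Tendsto (fun t => φ t • (G t).toEnd) (𝓝[>] 0)
          (𝓝 (rankOne (k : Mink n) (B.vMinus μ : Mink n))) := by
  obtain ⟨K, hK, hKinv, φ, hφ, hφK⟩ := exists_singular_asymptotics (Real.sqrt_nonneg _)
    (B.residue_mul hμ) hψ hb (G := fun t => (G t).toUnit) hG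
  rw [B.residue_sq_add hμ] at hKinv
  simp only [B.residue_sq_add hμ] at hK
  have happ : ∀ x : Mink n, Tendsto (fun t => t ^ √(1 - 2 * μ) •
      (G t).toEnd (-(mink n (B.vMinus μ) x • (B.vPlus μ : Mink n)))) (𝓝[>] 0) (𝓝 (K x)) := fun x =>
    ((ContinuousLinearMap.apply ℝ (Mink n) x).continuous.tendsto K).comp hK
  have hk : Tendsto (fun t => t ^ √(1 - 2 * μ) • (G t).toEnd (B.vPlus μ : Mink n)) (𝓝[>] 0)
      (𝓝 (K B.o)) := by
    refine (happ B.o).congr fun t => ?_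
    rw [B.mink_vMinus_o, neg_one_smul, neg_neg]
  have hKx : K = -rankOne (K B.o) (B.vMinus μ : Mink n) := by
    ext1 x
    refine tendsto_nhds_unique (happ x) ((hk.const_smul (-mink n (B.vMinus μ) x)).congr fun t => ?_)
      |>.trans ?_
    · rw [← neg_smul, map_smul, smul_comm]
    · exact neg_smul _ _
  have hinv : Tendsto (fun t => t ^ (-√(1 - 2 * μ)) • (G t)⁻¹.toEnd (K B.o)) (𝓝[>] 0)
      (𝓝 (B.vPlus μ : Mink n)) := by
    have h1 : Tendsto (fun t => t ^ (-√(1 - 2 * μ)) • (G t)⁻¹.toEnd (K B.o)) (𝓝[>] 0)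
        (𝓝 (-(mink n (B.vMinus μ) B.o • (B.vPlus μ : Mink n)))) :=
      ((ContinuousLinearMap.apply ℝ (Mink n) B.o).continuous.tendsto _).comp hKinv
    rwa [B.mink_vMinus_o, neg_one_smul, neg_neg] at h1
  have hne : K B.o ≠ 0 := by
    intro h
    simp only [h, map_zero, smul_zero] at hinv
    exact (B.vPlus μ).2.1 (tendsto_nhds_unique hinv tendsto_const_nhds)
  have hnull : mink n (K B.o) (K B.o) = 0 := by
    have h1 := (continuous_mink.tendsto (K B.o, K B.o)).comp (hk.prodMk_nhds hk)
    refine tendsto_nhds_unique h1 (tendsto_const_nhds.congr fun t => ?_)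
    simp only [Function.comp, map_smul, LinearMap.smul_apply, Lorentz.mink_toEnd, (B.vPlus μ).2.2,
      smul_zero]
  refine ⟨⟨K B.o, hne, hnull⟩, hinv, fun t => -(φ t)⁻¹, ?_, ?_⟩
  · filter_upwards [hφ.eventually_gt_atTop 0] with t ht
    exact neg_ne_zero.2 (inv_ne_zero ht.ne')
  · have h1 : Tendsto (fun t => (-1 : ℝ) • ((φ t)⁻¹ • (G t).toEnd)) (𝓝[>] 0) (𝓝 ((-1 : ℝ) • K)) :=
      hφK.const_smul (-1 : ℝ)
    have e1 : (-1 : ℝ) • K = rankOne (K B.o) (B.vMinus μ : Mink n) := by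
      conv_lhs => rw [hKx]
      module
    rw [e1] at h1
    refine h1.congr fun t => ?_
    rw [smul_smul, neg_one_mul]

/-- If `Γ` integrates `ψ`, then `Γ g` integrates the gauge transform of `ψ` by `g`. -/
theorem hasDerivAt_mul_gauge {Γ g : ℝ → Lorentz n} {ψ : ℝ → End n} {t : ℝ}
    (hΓ : HasDerivAt (fun τ => (Γ τ).toEnd) ((Γ t).toEnd * ψ t) t)
    (hg : DifferentiableAt ℝ (fun τ => (g τ).toEnd) t) :
    HasDerivAt (fun τ => (Γ τ * g τ).toEnd) ((Γ t * g t).toEnd * gauge g ψ t) t := by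
  refine (hΓ.mul hg.hasDerivAt).congr_deriv ?_
  have h1 : ∀ M : End n, (Γ t * g t).toEnd * ((g t)⁻¹.toEnd * M) = (Γ t).toEnd * M := by
    intro M
    rw [Lorentz.toEnd_mul, mul_assoc, ← mul_assoc (g t).toEnd, Lorentz.toEnd_mul_inv, one_mul]
  have h2 : gauge g ψ t = (g t)⁻¹.toEnd * (ψ t * (g t).toEnd) +
    (g t)⁻¹.toEnd * deriv (fun τ => (g τ).toEnd) t := rfl
  rw [h2, mul_add, h1, h1, ← mul_assoc]

/-- The Calapso transform converges if its gauge transformed primitive does. -/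
theorem tendsto_calapso (B : PseudoTriple n) {c : ℝ → LightCone n} {F Γ : ℝ → Lorentz n} {a μ : ℝ}
    {r φ : ℝ → ℝ} {k : LightCone n} (ha : 0 < a)
    (hlift : ∀ t ∈ Ioo 0 a, (F t).act B.oL.span = (c t).span)
    (hr0 : ∀ t ∈ Ioo 0 a, r t ≠ 0) (hφ : ∀ᶠ t in 𝓝[>] 0, φ t ≠ 0)
    (h : Tendsto (fun t => φ t • (Γ t * singularGauge B r F t).toEnd) (𝓝[>] 0)
      (𝓝 (rankOne (k : Mink n) (B.vMinus μ : Mink n)))) :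
    Tendsto (calapso c Γ) (𝓝[>] 0) (𝓝 k.span) := by
  have h1 : Tendsto (fun t => φ t • (Γ t * singularGauge B r F t).toEnd B.o) (𝓝[>] 0)
      (𝓝 (mink n (B.vMinus μ : Mink n) B.o • (k : Mink n))) :=
    ((ContinuousLinearMap.apply ℝ (Mink n) B.o).continuous.tendsto _).comp h
  rw [B.mink_vMinus_o] at h1
  have h2 : Tendsto (fun t => (-φ t) • (((Γ t * singularGauge B r F t).actCone B.oL : LightCone n) :
      Mink n)) (𝓝[>] 0) (𝓝 (k : Mink n)) := by
    have := h1.neg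
    rw [neg_one_smul, neg_neg] at this
    refine this.congr fun t => ?_
    rw [neg_smul]
    rfl
  refine (LightCone.tendsto_span (hφ.mono fun t ht => neg_ne_zero.2 ht) h2).congr' ?_
  filter_upwards [Ioo_mem_nhdsGT ha] with t ht
  rw [calapso, ← hlift t ht, Lorentz.act_span, Lorentz.act_span, LightCone.span_eq_iff]
  refine ⟨(r t)⁻¹, inv_ne_zero (hr0 t ht), ?_⟩
  change (Γ t).toEnd ((F t).toEnd ((B.boost (r t)).toEnd B.o)) = _
  rw [B.boost_o (hr0 t ht), map_smul, map_smul]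
  rfl

theorem HasPole.isBigO {Q : ℝ → ℝ} {b q : ℝ} (hb : 0 < b) (h : HasPole Q 0 b 2 q) :
    (fun t => Q t * t ^ 2 - q) =O[𝓝[>] 0] (fun t => t) := by
  obtain ⟨-, e, he, f, hf, hfQ, hf0⟩ := h
  have hd : DifferentiableAt ℝ f 0 :=
    (hf.contDiffAt (Ioo_mem_nhds (by linarith) hb)).differentiableAt (by simp)
  have h1 := hd.isBigO_sub.mono (nhdsWithin_le_nhds (s := Ioi 0))
  simp only [sub_zero, hf0] at h1
  refine h1.congr' ?_ (EventuallyEq.refl _ _)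
  filter_upwards [Ioo_mem_nhdsGT hb] with t ht
  rw [hfQ t ht]
  ring

namespace PseudoTriple

/-- The orthogonal projection onto the complement of `o` and `ι`. -/
def proj (B : PseudoTriple n) : End n := 1 + rankOne B.o B.ι + rankOne B.ι B.o

theorem proj_apply (B : PseudoTriple n) (x : Mink n) :
    B.proj x = x + mink n B.ι x • B.o + mink n B.o x • B.ι := rfl

theorem mink_o_proj (B : PseudoTriple n) (x : Mink n) : mink n B.o (B.proj x) = 0 := by
  simp [proj_apply, B.o_o, B.o_ι]

theorem mink_ι_proj (B : PseudoTriple n) (x : Mink n) : mink n B.ι (B.proj x) = 0 := by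
  simp [proj_apply, B.ι_ι, B.ι_o]

/-- The null rotation fixing `ι` and mapping `o` to `o + x + (⟪x, x⟫ / 2) ι`. -/
def nullRotation (B : PseudoTriple n) (x : Mink n) (hx : mink n B.ι x = 0) : Lorentz n :=
  Lorentz.ofIsometry
    (LinearMap.id + (wedge x B.ι).toLinearMap -
      (mink n x x / 2) • (rankOne B.ι B.ι).toLinearMap) (by
    intro y z
    change mink n (y + wedge x B.ι y - (mink n x x / 2) • rankOne B.ι B.ι y)
      (z + wedge x B.ι z - (mink n x x / 2) • rankOne B.ι B.ι z) = mink n y z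
    simp only [wedge_apply, rankOne_apply, map_sub, map_add, map_smul, LinearMap.sub_apply,
      LinearMap.add_apply, LinearMap.smul_apply, smul_eq_mul, B.ι_ι, hx, mink_comm x B.ι,
      mink_comm y B.ι, mink_comm y x]
    ring)

theorem toEnd_nullRotation (B : PseudoTriple n) (x : Mink n) (hx : mink n B.ι x = 0) :
    (B.nullRotation x hx).toEnd =
      1 + wedge x B.ι - (mink n x x / 2) • rankOne B.ι B.ι := rfl

end PseudoTriple

/-- A curve of null rotations integrates `x' ∧ ι`. -/
theorem hasDerivAt_nullRotation (B : PseudoTriple n) {x : ℝ → Mink n} {x' : Mink n} {t : ℝ}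
    (hxι : ∀ t, mink n B.ι (x t) = 0) (hx'ι : mink n B.ι x' = 0) (hx : HasDerivAt x x' t) :
    HasDerivAt (fun u => (B.nullRotation (x u) (hxι u)).toEnd)
      ((B.nullRotation (x t) (hxι t)).toEnd * wedge x' B.ι) t := by
  have h1 : HasDerivAt (fun u => -wedge B.ι (x u)) (-wedge B.ι x') t :=
    ((wedgeL B.ι).hasFDerivAt.comp_hasDerivAt t hx).neg
  have h2 := ((HasDerivAt.mink hx hx).div_const 2).smul_const (rankOne B.ι B.ι)
  have h3 := ((hasDerivAt_const t (1 : End n)).add h1).sub h2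
  refine (h3.congr_of_eventuallyEq (Eventually.of_forall fun u => ?_)).congr_deriv ?_
  · change (B.nullRotation (x u) (hxι u)).toEnd = 1 + -wedge B.ι (x u) - _
    rw [B.toEnd_nullRotation, wedge_swap]
  · rw [B.toEnd_nullRotation]
    ext1 z
    change (0 : Mink n) + -(wedge B.ι x' z) -
      ((mink n (x t) x' + mink n x' (x t)) / 2) • rankOne B.ι B.ι z =
      wedge x' B.ι z + wedge (x t) B.ι (wedge x' B.ι z) -
        (mink n (x t) (x t) / 2) • rankOne B.ι B.ι (wedge x' B.ι z)
    simp only [wedge_apply, rankOne_apply, map_sub, map_smul, B.ι_ι, hxι, hx'ι,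
      mink_comm (x t) B.ι, mink_comm x' (x t)]
    module

/-- A regular curve has a frame of null rotations near a point. -/
theorem exists_nullRotation_frame {ε b : ℝ} (hε : 0 < ε) (hb : 0 < b) {c : ℝ → LightCone n}
    (hc : IsRegularLift c (Ioo (-ε) b)) :
    ∃ (B : PseudoTriple n) (a m : ℝ) (F : ℝ → Lorentz n) (A : ℝ → End n), 0 < a ∧ a ≤ b ∧ 0 < m ∧
      (∀ t ∈ Ioo 0 a, HasDerivAt (fun τ => (F τ).toEnd) ((F t).toEnd * A t) t) ∧
      A =O[𝓝[>] 0] (fun _ => (1 : ℝ)) ∧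
      (∀ t ∈ Ioo 0 a, (F t).act B.oL.span = (c t).span) ∧
      (∀ t ∈ Ioo 0 a, mink n B.ι (A t B.o) = 0) ∧
      (fun t => (m * t)⁻¹ • A t B.o - t⁻¹ • B.τ) =O[𝓝[>] 0] (fun _ => (1 : ℝ)) := by
  have h0 : (0 : ℝ) ∈ Ioo (-ε) b := ⟨by linarith, hb⟩
  have hcs : ContDiffAt ℝ ∞ (fun t => (c t : Mink n)) 0 :=
    hc.smooth.contDiffAt (Ioo_mem_nhds h0.1 h0.2)
  have hcd := (hcs.differentiableAt (by simp)).hasDerivAt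
  have hli := hc.immersion 0 h0
  set c' := deriv (fun t => (c t : Mink n)) 0 with hc'
  have hcc : mink n (c 0 : Mink n) c' = 0 := by
    have h1 := HasDerivAt.mink hcd hcd
    have h2 : (fun u => mink n (c u : Mink n) (c u)) = fun _ => 0 := funext fun u => (c u).2.2
    rw [h2] at h1
    have := h1.unique (hasDerivAt_const 0 0)
    rw [mink_comm c'] at this
    linarith
  have hpos := mink_self_pos (c 0).2.2 hcc hli
  set m := √(mink n c' c') with hm
  have hm0 : 0 < m := Real.sqrt_pos.2 hpos
  have hmm : m * m = mink n c' c' := Real.mul_self_sqrt hpos.le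
  obtain ⟨B, hBo, hBτ⟩ : ∃ B : PseudoTriple n, B.o = c 0 ∧ m • B.τ = c' := by
    obtain ⟨y, hy⟩ := mink_nondegenerate (c 0).2.1
    set o : Mink n := (c 0).1 with ho
    set τ := m⁻¹ • c' with hτ
    have hττ : mink n τ τ = 1 := by
      simp only [hτ, map_smul, LinearMap.smul_apply, smul_eq_mul, ← hmm]
      field_simp
    have hoτ : mink n o τ = 0 := by simp [hτ, hcc]
    have hoo : mink n o o = 0 := (c 0).2.2
    set z := (-(mink n o y)⁻¹) • (y - mink n y τ • τ) with hz
    have hoz : mink n o z = -1 := by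
      simp only [hz, map_smul, map_sub, smul_eq_mul, hoτ, mul_zero, sub_zero]
      field_simp
    have hzτ : mink n z τ = 0 := by
      simp only [hz, map_smul, map_sub, LinearMap.smul_apply, LinearMap.sub_apply, smul_eq_mul, hττ]
      ring
    refine ⟨⟨o, z + (mink n z z / 2) • o, τ, hoo, ?_, ?_, hττ, hoτ, ?_⟩, rfl, ?_⟩
    · simp only [map_add, map_smul, LinearMap.add_apply, LinearMap.smul_apply, smul_eq_mul, hoo, hoz,
        mink_comm z o]
      ring
    · simp only [map_add, map_smul, smul_eq_mul, hoo, hoz]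
      ring
    · simp only [map_add, map_smul, LinearMap.add_apply, LinearMap.smul_apply, smul_eq_mul, hoτ, hzτ]
      ring
    · simp only [hτ, smul_smul, mul_inv_cancel₀ hm0.ne', one_smul]
  have hιc : mink n B.ι (c 0 : Mink n) = -1 := by rw [← hBo, B.ι_o]
  have hιc' : mink n B.ι c' = 0 := by rw [← hBτ, map_smul, B.ι_τ, smul_zero]
  set d : ℝ → ℝ := fun t => -(mink n B.ι (c t : Mink n)) with hd
  have hds : ContDiffAt ℝ ∞ d 0 := ((minkL n B.ι).contDiff.contDiffAt.comp 0 hcs).neg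
  have hd0 : d 0 = 1 := by simp only [hd, hιc, neg_neg]
  have hdd : HasDerivAt d 0 0 := by
    have := (HasDerivAt.mink (hasDerivAt_const 0 B.ι) hcd).neg
    exact this.congr_deriv (by simp [hιc'])
  set f : ℝ → Mink n := fun t => (d t)⁻¹ • (c t : Mink n) with hf
  have hfs : ContDiffAt ℝ ∞ f 0 := (hds.inv (by rw [hd0]; exact one_ne_zero)).smul hcs
  have hfd : HasDerivAt f c' 0 := by
    refine ((hdd.inv (by rw [hd0]; exact one_ne_zero)).smul hcd).congr_deriv ?_
    simp [hd0]
  have hf's : ContDiffAt ℝ 1 (deriv f) 0 :=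
    (hfs.fderiv_right (m := 1) (by norm_cast)).clm_apply contDiffAt_const
  have hdf : ∀ᶠ t in 𝓝 (0 : ℝ), HasDerivAt f (deriv f t) t := by
    filter_upwards [(hfs.of_le (m := 1) (by norm_cast)).eventually (by simp)] with t ht
    exact (ht.differentiableAt (by simp)).hasDerivAt
  have hdne : ∀ᶠ t in 𝓝 (0 : ℝ), d t ≠ 0 :=
    hds.continuousAt.eventually_ne (by rw [hd0]; exact one_ne_zero)
  obtain ⟨a, ha, hsub⟩ := mem_nhdsGT_iff_exists_Ioo_subset.1
    (nhdsWithin_le_nhds (s := Ioi 0) (hdf.and hdne))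
  have ha0 : (0 : ℝ) < a := ha
  have hsub' : ∀ t ∈ Ioo 0 (min a b), HasDerivAt f (deriv f t) t ∧ d t ≠ 0 := fun t ht =>
    hsub ⟨ht.1, ht.2.trans_le (min_le_left _ _)⟩
  have hAo : ∀ t, wedge (B.proj (deriv f t)) B.ι B.o = B.proj (deriv f t) := by
    intro t
    rw [wedge_apply, mink_comm, B.mink_o_proj, B.ι_o]
    simp
  have hp0 : B.proj (deriv f 0) = m • B.τ := by
    rw [hfd.deriv, ← hBτ, map_smul, B.proj_apply, B.ι_τ, B.o_τ]
    simp
  have hdiff : (fun t => B.proj (deriv f t) - m • B.τ) =O[𝓝[>] 0] (fun t => t) := by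
    have h1 := ((hf's.differentiableAt (by simp)).isBigO_sub).mono
      (nhdsWithin_le_nhds (s := Ioi 0))
    simp only [sub_zero] at h1
    refine ((B.proj.isBigO_comp _ _).trans h1).congr_left fun t => ?_
    rw [map_sub, hp0]
  refine ⟨B, min a b, m, fun t => B.nullRotation (B.proj (f t)) (B.mink_ι_proj _),
    fun t => wedge (B.proj (deriv f t)) B.ι, lt_min ha0 hb, min_le_right _ _, hm0, ?_, ?_, ?_, ?_, ?_⟩
  · intro t ht
    exact hasDerivAt_nullRotation B (fun t => B.mink_ι_proj _) (B.mink_ι_proj _)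
      (B.proj.hasFDerivAt.comp_hasDerivAt t (hsub' t ht).1)
  · have h1 : Tendsto (fun t => -wedgeL B.ι (B.proj (deriv f t))) (𝓝[>] 0)
        (𝓝 (-wedgeL B.ι (B.proj (deriv f 0)))) := by
      have := (wedgeL B.ι).continuous.comp B.proj.continuous
      exact ((this.continuousAt.comp hf's.continuousAt).neg).tendsto.mono_left nhdsWithin_le_nhds
    refine (h1.isBigO_one ℝ).congr_left fun t => ?_
    rw [wedge_swap]
    rfl
  · intro t ht
    have hdt := (hsub' t ht).2
    have hιf : mink n B.ι (f t) = -1 := by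
      have : mink n B.ι (c t : Mink n) = -d t := by simp [hd]
      simp only [hf, map_smul, smul_eq_mul, this]
      field_simp
    have hff : mink n (f t) (f t) = 0 := by simp [hf, (c t).2.2]
    rw [Lorentz.act_span, LightCone.span_eq_iff]
    refine ⟨(d t)⁻¹, inv_ne_zero hdt, ?_⟩
    change (B.nullRotation (B.proj (f t)) (B.mink_ι_proj _)).toEnd B.o = f t
    rw [B.toEnd_nullRotation]
    change B.o + wedge (B.proj (f t)) B.ι B.o -
      (mink n (B.proj (f t)) (B.proj (f t)) / 2) • rankOne B.ι B.ι B.o = f t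
    rw [wedge_apply, mink_comm, B.mink_o_proj, B.ι_o, rankOne_apply, B.ι_o]
    simp only [B.proj_apply, hιf, map_add, map_smul, LinearMap.add_apply, LinearMap.smul_apply,
      smul_eq_mul, hff, B.o_o, B.ι_ι, B.o_ι, B.ι_o, mink_comm (f t) B.o, mink_comm (f t) B.ι]
    module
  · intro t _
    rw [hAo, B.mink_ι_proj]
  · have h1 : (fun t : ℝ => m⁻¹ • (t⁻¹ • (B.proj (deriv f t) - m • B.τ))) =O[𝓝[>] 0]
        (fun t => t⁻¹ * t) :=
      ((Asymptotics.isBigO_refl (fun t : ℝ => t⁻¹) (𝓝[>] 0)).smul hdiff).const_smul_left m⁻¹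
    refine h1.congr' ?_ ?_
    · refine Eventually.of_forall fun t => ?_
      simp only [hAo]
      rw [smul_sub, smul_sub, smul_smul, smul_smul, smul_smul, mul_inv,
        show m⁻¹ * t⁻¹ * m = t⁻¹ by field_simp]
    · filter_upwards [self_mem_nhdsWithin] with t ht
      exact inv_mul_cancel₀ (ne_of_gt ht)

end Moebius

end

namespace Moebius

variable {n : ℕ}

/-- Convergence of the Calapso transforms at a pole of second order. -/
theorem exists_tendsto_calapso {ε b : ℝ} (hε : 0 < ε) (hb : 0 < b) {c : ℝ → LightCone n}
    (hc : IsRegularLift c (Ioo (-ε) b)) {Q : ℝ → ℝ} {q : ℝ} (hpole : HasPole Q 0 b 2 q) {lam : ℝ}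
    (hlam : 0 ≤ 1 - 2 * (lam * q)) {p : ℝ} {Γ : ℝ → Lorentz n}
    (hΓ : IsPrimitive (fun t => lam • assocForm c Q t) (Ioo 0 b) p Γ) :
    ∃ P : Sphere n, Tendsto (calapso c Γ) (𝓝[>] 0) (𝓝 P) := by
  obtain ⟨B, a, m, F, A, ha, hab, hm, hF, hA, hlift, hι, hξ⟩ := exists_nullRotation_frame hε hb hc
  have hcd : ∀ t ∈ Ioo 0 a, DifferentiableAt ℝ (fun u => (c u : Mink n)) t := fun t ht =>
    (hc.smooth.contDiffAt (Ioo_mem_nhds (by linarith [ht.1]) (by linarith [ht.2]))).differentiableAt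
      (by simp)
  have hr : ∀ t : ℝ, HasDerivAt (fun t => m * t) m t := fun t =>
    ((hasDerivAt_id t).const_mul m).congr_deriv (mul_one m)
  have hr0 : ∀ t ∈ Ioo 0 a, m * t ≠ 0 := fun t ht => (mul_pos hm ht.1).ne'
  have hid : Tendsto (fun t : ℝ => t) (𝓝[>] 0) (𝓝 0) := tendsto_id.mono_left nhdsWithin_le_nhds
  have hψ := gauge_singularGauge_isBigO (lam := lam) (r' := fun _ => m) B ha hF hA hlift hcd
    (fun t _ => hr t) hr0 ((hid.const_mul m).isBigO_one ℝ) (by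
      refine (Asymptotics.isBigO_zero _ _).congr_left fun t => ?_
      rw [← div_div, div_self hm.ne', one_div, sub_self]) hι hξ (hpole.isBigO hb)
  have hG := fun t (ht : t ∈ Ioo 0 a) => hasDerivAt_mul_gauge (Γ := Γ)
    (ψ := fun t => lam • assocForm c Q t) (hΓ.hasDerivAt t ⟨ht.1, ht.2.trans_le hab⟩)
    (hasDerivAt_singularGauge B (hF t ht) (hr t) (hr0 t ht)).differentiableAt
  obtain ⟨k, -, φ, hφ, hk⟩ := exists_primitive_asymptotics B hlam hψ ha hG
  exact ⟨k.span, tendsto_calapso B ha hlift hr0 hφ hk⟩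

namespace IsPolarParameter

variable {Q s : ℝ → ℝ} {q δ b : ℝ}

theorem pos (hs : IsPolarParameter Q q δ b s) (hδ : 0 < δ) {t : ℝ} (ht : t ∈ Ioo 0 b) :
    0 < s t := by
  have h := strictMonoOn_of_deriv_pos (convex_Ioo (-δ) b) hs.smooth.continuousOn
    (fun x hx => hs.deriv_pos x (by rwa [interior_Ioo] at hx))
  have := h (a := 0) ⟨by linarith, ht.1.trans ht.2⟩ (b := t) ⟨by linarith [ht.1], ht.2⟩ ht.1
  rwa [hs.zero] at this

theorem hasDerivAt (hs : IsPolarParameter Q q δ b s) {t : ℝ} (ht : t ∈ Ioo (-δ) b) :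
    HasDerivAt s (deriv s t) t :=
  ((hs.smooth.contDiffAt (Ioo_mem_nhds ht.1 ht.2)).differentiableAt (by simp)).hasDerivAt

/-- The logarithmic derivative of a polar parameter has a simple pole with residue `1`. -/
theorem isBigO (hs : IsPolarParameter Q q δ b s) (hδ : 0 < δ) (hb : 0 < b)
    (hpole : HasPole Q 0 b 2 q) :
    (fun t => deriv s t / s t - t⁻¹) =O[𝓝[>] 0] (fun _ => (1 : ℝ)) := by
  have hq : 0 < |q| := abs_pos.2 hpole.1
  have h1 : (fun t => t⁻¹ * (Q t * t ^ 2 - q)) =O[𝓝[>] 0] (fun _ => (1 : ℝ)) := by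
    refine ((Asymptotics.isBigO_refl (fun t : ℝ => t⁻¹) (𝓝[>] 0)).mul (hpole.isBigO hb)).congr'
      (EventuallyEq.refl _ _) ?_
    filter_upwards [self_mem_nhdsWithin] with t ht
    exact inv_mul_cancel₀ (ne_of_gt ht)
  refine (Asymptotics.IsBigO.of_bound |q|⁻¹ ?_).trans h1
  filter_upwards [Ioo_mem_nhdsGT hb] with t ht
  have hst := hs.pos hδ ht
  have hs't := hs.deriv_pos t ⟨by linarith [ht.1], ht.2⟩
  have ht0 := ht.1
  set x := t * (deriv s t / s t) with hx
  have hx0 : 0 < x := by positivity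
  have e1 : deriv s t / s t - t⁻¹ = t⁻¹ * (x - 1) := by
    rw [hx]
    field_simp
  have e2 : Q t * t ^ 2 - q = q * (x ^ 2 - 1) := by
    rw [hs.eq t ht, hx]
    field_simp
  rw [e1, e2, norm_mul, norm_mul, norm_mul, Real.norm_eq_abs q, ← mul_assoc, mul_comm |q|⁻¹, mul_assoc,
    inv_mul_cancel_left₀ hq.ne']
  refine mul_le_mul_of_nonneg_left ?_ (norm_nonneg _)
  rw [show x ^ 2 - 1 = (x - 1) * (x + 1) by ring, norm_mul]
  refine le_mul_of_one_le_right (norm_nonneg _) ?_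
  rw [Real.norm_eq_abs, abs_of_pos (by linarith)]
  linarith

end IsPolarParameter

/-- The limit of the Calapso transforms in terms of the singular gauge transformation. -/
theorem exists_limit_cone {ε δ b : ℝ} (hδ : 0 < δ) (hδε : δ ≤ ε) (hb : 0 < b)
    {c : ℝ → LightCone n} (hc : IsRegularLift c (Ioo (-ε) b)) {Q : ℝ → ℝ} {q : ℝ}
    (hpole : HasPole Q 0 b 2 q) {lam : ℝ} (hlam : 0 ≤ 1 - 2 * (lam * q)) {s : ℝ → ℝ}
    (hs : IsPolarParameter Q q δ b s) {B : PseudoTriple n} {F : ℝ → Lorentz n}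
    (hF : IsFrame B c s (Ioo (-δ) b) F) {G : ℝ → ℝ → Lorentz n}
    (hG : ∀ p ∈ Ioo 0 b, IsPrimitive
      (gauge (singularGauge B s F) (fun t => lam • assocForm c Q t)) (Ioo 0 b) p (G p)) :
    ∃ k : ℝ → LightCone n, ContinuousOn k (Ico 0 b) ∧ (k 0).span = (B.vPlus (lam * q)).span ∧
      (∀ p ∈ Ioo 0 b, ∀ t ∈ Ioo 0 b, (k t).span = (G t p).act (k p).span) ∧
      (∀ p ∈ Ioo 0 b, Tendsto (fun t => (G p t).projEnd) (𝓝[>] 0)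
        (𝓝 ((k p).projRankOne (B.vMinus (lam * q))))) ∧
      (∀ p ∈ Ioo 0 b, ∀ Γ : ℝ → Lorentz n,
        IsPrimitive (fun t => lam • assocForm c Q t) (Ioo 0 b) p Γ →
          Tendsto (calapso c Γ) (𝓝[>] 0) (𝓝 ((singularGauge B s F p).act (k p).span))) := by
  have hsub : ∀ t ∈ Ioo 0 b, t ∈ Ioo (-δ) b := fun t ht => ⟨by linarith [ht.1], ht.2⟩
  have h0 : (0 : ℝ) ∈ Ioo (-δ) b := ⟨by linarith, hb⟩
  have hcd : ∀ t ∈ Ioo 0 b, DifferentiableAt ℝ (fun u => (c u : Mink n)) t := fun t ht =>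
    (hc.smooth.contDiffAt (Ioo_mem_nhds (by linarith [ht.1]) ht.2)).differentiableAt (by simp)
  have hs0 : ∀ t ∈ Ioo 0 b, s t ≠ 0 := fun t ht => (hs.pos hδ ht).ne'
  obtain ⟨F', hF'⟩ : ∃ F' : ℝ → End n, F' = deriv fun τ => (F τ).toEnd := ⟨_, rfl⟩
  have hFd : ∀ t ∈ Ioo (-δ) b, HasDerivAt (fun τ => (F τ).toEnd) (F' t) t := fun t ht => by
    rw [hF']
    exact ((hF.smooth.contDiffAt (Ioo_mem_nhds ht.1 ht.2)).differentiableAt (by simp)).hasDerivAt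
  have hFA : ∀ t ∈ Ioo 0 b, HasDerivAt (fun τ => (F τ).toEnd)
      ((F t).toEnd * ((F t)⁻¹.toEnd * F' t)) t := fun t ht => by
    rw [← mul_assoc, Lorentz.toEnd_mul_inv, one_mul]
    exact hFd t (hsub t ht)
  have hAo : ∀ t ∈ Ioo 0 b, ((F t)⁻¹.toEnd * F' t) B.o = deriv s t • B.τ := by
    intro t ht
    have h1 := (hasDerivAt_mul_apply (hFA t ht) B.o).deriv.symm.trans (hF.tangent t (hsub t ht))
    rw [← map_smul] at h1
    rw [← (F t).inv_apply (deriv s t • B.τ), ← h1, Lorentz.inv_apply]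
  have hA : (fun t => (F t)⁻¹.toEnd * F' t) =O[𝓝[>] 0] (fun _ => (1 : ℝ)) := by
    have h1 : ContinuousAt F' 0 := by
      rw [hF']
      exact (hF.smooth.continuousOn_deriv_of_isOpen isOpen_Ioo (by simp)).continuousAt
        (Ioo_mem_nhds h0.1 h0.2)
    have h2 := (Lorentz.hasDerivAt_inv (hFd 0 h0)).continuousAt.mul h1
    exact (h2.tendsto.mono_left nhdsWithin_le_nhds).isBigO_one ℝ
  have hs1 : s =O[𝓝[>] 0] (fun _ => (1 : ℝ)) :=
    ((hs.hasDerivAt h0).continuousAt.tendsto.mono_left nhdsWithin_le_nhds).isBigO_one ℝ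
  have hs2 := hs.isBigO hδ hb hpole
  have hξ : (fun t => (s t)⁻¹ • ((F t)⁻¹.toEnd * F' t) B.o - t⁻¹ • B.τ) =O[𝓝[>] 0]
      (fun _ => (1 : ℝ)) := by
    have h1 : (fun t => (deriv s t / s t - t⁻¹) • B.τ) =O[𝓝[>] 0] (fun _ => (1 : ℝ)) := by
      refine (hs2.smul (Asymptotics.isBigO_const_const B.τ (one_ne_zero (α := ℝ)) (𝓝[>] 0))).congr_right
        fun t => ?_
      simp
    refine h1.congr' ?_ (EventuallyEq.refl _ _)
    filter_upwards [Ioo_mem_nhdsGT hb] with t ht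
    rw [hAo t ht, sub_smul, smul_smul, div_eq_inv_mul]
  have hlift : ∀ t ∈ Ioo 0 b, (F t).act B.oL.span = (c t).span := fun t ht => hF.lift t (hsub t ht)
  have hψ := gauge_singularGauge_isBigO (lam := lam) B hb hFA hA hlift hcd
    (fun t ht => hs.hasDerivAt (hsub t ht)) hs0 hs1 hs2
    (fun t ht => by rw [hAo t ht, map_smul, B.ι_τ, smul_zero]) hξ (hpole.isBigO hb)
  have hgd : ∀ t ∈ Ioo 0 b, DifferentiableAt ℝ (fun τ => (singularGauge B s F τ).toEnd) t :=
    fun t ht => (hasDerivAt_singularGauge B (hFA t ht) (hs.hasDerivAt (hsub t ht))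
      (hs0 t ht)).differentiableAt
  obtain ⟨p₀, hp₀⟩ : ∃ p₀, p₀ ∈ Ioo 0 b := ⟨b / 2, by linarith, by linarith⟩
  have hcocycle : ∀ p ∈ Ioo 0 b, ∀ t ∈ Ioo 0 b, G p t = (G p₀ p)⁻¹ * G p₀ t := by
    intro p hp t ht
    have := mul_inv_eq_of_hasDerivAt (hG p hp).hasDerivAt (hG p₀ hp₀).hasDerivAt hp ht
    rw [(hG p hp).init, one_mul] at this
    rw [← this, inv_mul_cancel_right]
  obtain ⟨k₀, hk₀, φ, hφ, hφk⟩ := exists_primitive_asymptotics B hlam hψ hb (hG p₀ hp₀).hasDerivAt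
  classical
  set ζ := √(1 - 2 * (lam * q)) with hζ
  obtain ⟨k, hk, hk'⟩ : ∃ k : ℝ → LightCone n,
      (∀ t ∈ Ioo 0 b, (k t : Mink n) = t ^ (-ζ) • (G p₀ t)⁻¹.toEnd k₀) ∧
        k 0 = B.vPlus (lam * q) := by
    refine ⟨fun t => if ht : t ∈ Ioo 0 b then ⟨t ^ (-ζ) • (G p₀ t)⁻¹.toEnd k₀,
      smul_ne_zero (Real.rpow_pos_of_pos ht.1 _).ne' ((G p₀ t)⁻¹.toEnd_ne_zero k₀.2.1), by
        simp only [map_smul, LinearMap.smul_apply, Lorentz.mink_toEnd, k₀.2.2, smul_zero]⟩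
      else B.vPlus (lam * q), fun t ht => ?_, ?_⟩
    · simp only [dif_pos ht]
    · exact dif_neg (fun h => lt_irrefl _ h.1)
  have hlim : ∀ p ∈ Ioo 0 b, Tendsto (fun t => (p ^ (-ζ) * φ t) • (G p t).toEnd) (𝓝[>] 0)
      (𝓝 (rankOne (k p : Mink n) (B.vMinus (lam * q) : Mink n))) := by
    intro p hp
    have h1 : Tendsto (fun t => p ^ (-ζ) • ((G p₀ p)⁻¹.toEnd * (φ t • (G p₀ t).toEnd))) (𝓝[>] 0)
        (𝓝 (p ^ (-ζ) • ((G p₀ p)⁻¹.toEnd *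
          rankOne (k₀ : Mink n) (B.vMinus (lam * q) : Mink n)))) :=
      (hφk.const_mul ((G p₀ p)⁻¹.toEnd)).const_smul (p ^ (-ζ))
    have e1 : p ^ (-ζ) • ((G p₀ p)⁻¹.toEnd * rankOne (k₀ : Mink n) (B.vMinus (lam * q) : Mink n)) =
        rankOne (k p : Mink n) (B.vMinus (lam * q) : Mink n) := by
      rw [hk p hp]
      ext1 x
      change p ^ (-ζ) • (G p₀ p)⁻¹.toEnd (mink n _ x • (k₀ : Mink n)) = mink n _ x • _
      rw [map_smul, smul_comm]
    rw [e1] at h1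
    refine h1.congr' ?_
    filter_upwards [Ioo_mem_nhdsGT hb] with t ht
    rw [hcocycle p hp t ht, Lorentz.toEnd_mul, mul_smul_comm, smul_smul]
  have hφ' : ∀ p ∈ Ioo 0 b, ∀ᶠ t in 𝓝[>] 0, p ^ (-ζ) * φ t ≠ 0 := fun p hp =>
    hφ.mono fun t ht => mul_ne_zero (Real.rpow_pos_of_pos hp.1 _).ne' ht
  refine ⟨k, ?_, by rw [hk'], ?_, ?_, ?_⟩
  · intro t ht
    refine tendsto_subtype_rng.2 ?_
    change ContinuousWithinAt (fun u => (k u : Mink n)) (Ico 0 b) t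
    rcases ht.1.eq_or_lt with rfl | h
    · rw [← Ioo_insert_left hb, continuousWithinAt_insert_self, ContinuousWithinAt, hk',
        nhdsWithin_Ioo_eq_nhdsGT hb]
      refine hk₀.congr' ?_
      filter_upwards [Ioo_mem_nhdsGT hb] with t ht
      rw [hk t ht]
    · have htb : t ∈ Ioo 0 b := ⟨h, ht.2⟩
      refine ContinuousAt.continuousWithinAt ?_
      have hinv := Lorentz.hasDerivAt_inv ((hG p₀ hp₀).hasDerivAt t htb)
      have h1 : ContinuousAt (fun u => u ^ (-ζ) • (G p₀ u)⁻¹.toEnd (k₀ : Mink n)) t :=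
        (Real.continuousAt_rpow_const t (-ζ) (Or.inl h.ne')).smul
          (hinv.continuousAt.clm_apply continuousAt_const)
      refine h1.congr ?_
      filter_upwards [Ioo_mem_nhds h ht.2] with u hu
      rw [hk u hu]
  · intro p hp t ht
    rw [Lorentz.act_span, LightCone.span_eq_iff]
    have hpζ := Real.rpow_pos_of_pos hp.1 (-ζ)
    have htζ := Real.rpow_pos_of_pos ht.1 (-ζ)
    refine ⟨t ^ (-ζ) * (p ^ (-ζ))⁻¹, (mul_pos htζ (inv_pos.2 hpζ)).ne', ?_⟩
    rw [Lorentz.coe_actCone, hk p hp, hk t ht, map_smul, hcocycle t ht p hp, smul_smul,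
      inv_mul_cancel_right₀ hpζ.ne', Lorentz.toEnd_mul]
    change _ = t ^ (-ζ) • (G p₀ t)⁻¹.toEnd ((G p₀ p).toEnd ((G p₀ p)⁻¹.toEnd k₀))
    rw [Lorentz.apply_inv]
  · intro p hp
    exact tendsto_mk _ _ (hφ' p hp) (hlim p hp)
  · intro p hp Γ hΓ
    rw [Lorentz.act_span]
    refine tendsto_calapso (r := s) (μ := lam * q) B hb hlift hs0 (hφ' p hp) ?_
    have h1 : ∀ t ∈ Ioo 0 b, Γ t * singularGauge B s F t = singularGauge B s F p * G p t := by
      intro t ht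
      have := mul_inv_eq_of_hasDerivAt (fun u hu => hasDerivAt_mul_gauge (hΓ.hasDerivAt u hu) (hgd u hu))
        (hG p hp).hasDerivAt hp ht
      rw [(hG p hp).init, hΓ.init, inv_one, one_mul, mul_one] at this
      rw [← this, inv_mul_cancel_right]
    have h2 := (hlim p hp).const_mul (singularGauge B s F p).toEnd
    have e1 : (singularGauge B s F p).toEnd *
        rankOne (k p : Mink n) (B.vMinus (lam * q) : Mink n) =
        rankOne ((singularGauge B s F p).actCone (k p) : Mink n) (B.vMinus (lam * q) : Mink n) := by
      ext1 x
      exact map_smul (singularGauge B s F p).toEnd (mink n (B.vMinus (lam * q)) x) (k p : Mink n)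
    rw [e1] at h2
    refine h2.congr' ?_
    filter_upwards [Ioo_mem_nhdsGT hb] with t ht
    rw [h1 t ht, Lorentz.toEnd_mul, mul_smul_comm]

end Moebius

theorem theorem5p3 (n : ℕ) (ε b : ℝ) (hε : 0 < ε) (hb : 0 < b)
    (c : ℝ → Moebius.LightCone n) (hc : Moebius.IsRegularLift c (Set.Ioo (-ε) b))
    (Q : ℝ → ℝ) (hQ : ∀ t ∈ Set.Ioo 0 b, Q t ≠ 0)
    (q : ℝ) (hpole : Moebius.HasPole Q 0 b 2 q)
    (lam : ℝ) (hlam : 0 ≤ 1 - 2 * (lam * q)) :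
    (∀ p ∈ Set.Ioo 0 b, ∀ Γ : ℝ → Moebius.Lorentz n,
      Moebius.IsPrimitive (fun t => lam • Moebius.assocForm c Q t) (Set.Ioo 0 b) p Γ →
        ∃ P : Moebius.Sphere n,
          Filter.Tendsto (Moebius.calapso c Γ) (nhdsWithin 0 (Set.Ioi 0)) (nhds P)) ∧
    (∀ δ : ℝ, 0 < δ → δ ≤ ε →
      ∀ s : ℝ → ℝ, Moebius.IsPolarParameter Q q δ b s →
      ∀ (B : Moebius.PseudoTriple n) (F : ℝ → Moebius.Lorentz n),
      Moebius.IsFrame B c s (Set.Ioo (-δ) b) F →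
      ∀ G : ℝ → ℝ → Moebius.Lorentz n,
      (∀ p ∈ Set.Ioo 0 b, Moebius.IsPrimitive
        (Moebius.gauge (Moebius.singularGauge B s F) (fun t => lam • Moebius.assocForm c Q t))
        (Set.Ioo 0 b) p (G p)) →
      ∃ k : ℝ → Moebius.LightCone n,
        ContinuousOn k (Set.Ico 0 b) ∧
        (k 0).span = (B.vPlus (lam * q)).span ∧
        (∀ p ∈ Set.Ioo 0 b, ∀ t ∈ Set.Ioo 0 b, (k t).span = (G t p).act (k p).span) ∧
        (∀ p ∈ Set.Ioo 0 b, Filter.Tendsto (fun t => (G p t).projEnd)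
          (nhdsWithin 0 (Set.Ioi 0)) (nhds ((k p).projRankOne (B.vMinus (lam * q))))) ∧
        (∀ p ∈ Set.Ioo 0 b, ∀ Γ : ℝ → Moebius.Lorentz n,
          Moebius.IsPrimitive (fun t => lam • Moebius.assocForm c Q t) (Set.Ioo 0 b) p Γ →
            Filter.Tendsto (Moebius.calapso c Γ) (nhdsWithin 0 (Set.Ioi 0))
              (nhds ((Moebius.singularGauge B s F p).act (k p).span)))) := by
  refine ⟨fun p _ Γ hΓ => Moebius.exists_tendsto_calapso hε hb hc hpole hlam hΓ, ?_⟩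
  intro δ hδ hδε s hs B F hF G hG
  exact Moebius.exists_limit_cone hδ hδε hb hc hpole hlam hs hF hG
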